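/- Let $\mathbb F$ be a field of characteristic $\ne 2$, let $\zeta_1,\dots,\zeta_6\in\mathbb F$ be pairwise distinct, and put $\zeta_{ij}=\zeta_i-\zeta_j$. Consider a Grassmann algebra over $\mathbb F$ (unital associative, with generators that anticommute pairwise) whose generators include $a_{ijkl}$ and $b_{ijkl}$ for all $1\le i<j<k<l\le 6$, and possibly further ones. The Berezin integral over a generator $x$ is the $\mathbb F$-linear map with $\int \mathrm dx=0$, $\int x\,\mathrm dx=1$, $\int gh\,\mathrm dx=g\int h\,\mathrm dx$ if $g$ does not depend on $x$; in a multiple integral $\int f\,\mathrm dx_1\,\mathrm dx_2\cdots\mathrm dx_n$ one integrates first over $x_1$, then over $x_2$, etc. Let $\partial/\partial x$ be the left derivative. For $i<j<k<l<m$ let \begin{align*} \mathcal W_{ijklm}=\frac1{\zeta_{lm}}&(\zeta_{kl}a_{ijkl}-\zeta_{km}a_{ijkm}+\zeta_{lm}a_{ijlm}-\zeta_{lm}a_{iklm})\\ \times&(\zeta_{kl}b_{ijkl}-\zeta_{km}b_{ijkm}+\zeta_{lm}b_{ijlm}+\zeta_{lm}a_{jklm})\\ \times&(-\zeta_{il}a_{ijkl}-\zeta_{jl}b_{ijkl}+\zeta_{im}a_{ijkm}+\zeta_{jm}b_{ijkm}-\zeta_{lm}b_{iklm}+\zeta_{lm}b_{jklm}).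 \end{align*} The $3\to3$ Pachner move replaces the cluster of 4-simplices $(12345),(12346),(12356)$ (l.h.s.) by the cluster $(12456),(13456),(23456)$ (r.h.s.). Orient all six 4-simplices consistently, that is, so that the oriented boundaries of the two clusters coincide. For a 2-face $klm$, its oriented link in a cluster is the set of ordered pairs $(ij)$ such that $\{i,j,k,l,m\}$ is the vertex set of a 4-simplex of the cluster and the order $i,j,k,l,m$ gives the chosen orientation of that simplex. Let $e$ be an odd element, and let $\alpha_{\{ijklm\}}$ be an even element for each of the six 4-simplices, all of them independent of the twelve integration variables in the identity below, such that for every 2-face $klm$, $k<l<m$, of the two clusters $$\sum_{(ij)\text{ in the oriented link of }klm\text{ in the l.h.s.}}\zeta_{ij}\,\alpha_{\{ijklm\}}=\sum_{(ij)\text{ in the oriented link of }klm\text{ in the r.h.s.}}\zeta_{ij}\,\alpha_{\{ijklm\}}$$ (an empty sum is zero). Put $\tilde{\mathcal W}_{ijklm}=\mathcal W_{ijklm}+\alpha_{\{ijklm\}}e$. For a 2-face $s$ of a cluster let $d_s=\sum_{t\supset s}d_{t,s}$, the sum over the tetrahedra $t$ of the cluster that contain $s$, where for $t=(ijkl)$,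 $i<j<k<l$, $$d_{t,s}=\begin{cases}(\zeta_{jk}/\zeta_{kl})\,\partial/\partial a_{ijkl}-(\zeta_{ik}/\zeta_{kl})\,\partial/\partial b_{ijkl}& s=(ijk),\\ -(\zeta_{jl}/\zeta_{kl})\,\partial/\partial a_{ijkl}+(\zeta_{il}/\zeta_{kl})\,\partial/\partial b_{ijkl}& s=(ijl),\\ \partial/\partial a_{ijkl}& s=(ikl),\\ -\partial/\partial b_{ijkl}& s=(jkl).\end{cases}$$ Then, for all homogeneous elements $w_{123},w_{456}$ with $d_{123}w_{123}=1$ and $d_{456}w_{456}=1$ (where $d_{123}$ is taken in the l.h.s. and $d_{456}$ in the r.h.s.), \begin{multline*} \int\tilde{\mathcal W}_{12345}\tilde{\mathcal W}_{12346}\tilde{\mathcal W}_{12356}\,w_{123}\,\frac{\mathrm da_{1234}\,\mathrm db_{1234}}{\zeta_{34}}\frac{\mathrm da_{1235}\,\mathrm db_{1235}}{\zeta_{35}}\frac{\mathrm da_{1236}\,\mathrm db_{1236}}{\zeta_{36}}\\ =\int\tilde{\mathcal W}_{12456}\tilde{\mathcal W}_{13456}\tilde{\mathcal W}_{23456}\,w_{456}\,\frac{\mathrm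 da_{1456}\,\mathrm db_{1456}}{\zeta_{56}}\frac{\mathrm da_{2456}\,\mathrm db_{2456}}{\zeta_{56}}\frac{\mathrm da_{3456}\,\mathrm db_{3456}}{\zeta_{56}}. \end{multline*} Moreover, such elements exist: for instance, $w_{123}=\zeta_{23}^{-1}\zeta_{34}a_{1234}$ and $w_{456}=-b_{1456}$ satisfy $d_{123}w_{123}=1$ and $d_{456}w_{456}=1$. -/

import Mathlib

noncomputable section

open scoped BigOperators

namespace Pachner

/-! ## Grassmann algebras, left derivatives and Berezin integrals -/

/-- The Grassmann algebra over `F` with one anticommuting generator for each element of `ι`. -/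
abbrev Grassmann (F : Type*) [Field F] (ι : Type*) : Type _ :=
  ExteriorAlgebra F (ι →₀ F)

section Grassmann

variable {F : Type*} [Field F] {ι : Type*}

/-- The Grassmann generator with index `i`. -/
def gen (i : ι) : Grassmann F ι :=
  ExteriorAlgebra.ι F (Finsupp.single i 1)

/-- Even elements: sums of monomials of even degree. -/
def IsEven (x : Grassmann F ι) : Prop :=
  x ∈ CliffordAlgebra.evenOdd (0 : QuadraticForm F (ι →₀ F)) 0

/-- Odd elements: sums of monomials of odd degree. -/
def IsOdd (x : Grassmann F ι) : Prop :=
  x ∈ CliffordAlgebra.evenOdd (0 : QuadraticForm F (ι →₀ F)) 1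

/-- Homogeneous elements: those of some fixed degree `n`. -/
def IsHomogeneous (x : Grassmann F ι) : Prop :=
  ∃ n : ℕ, x ∈ ⋀[F]^n (ι →₀ F)

/-- `x` does not depend on the generators with index in `S`: it is a polynomial in the others. -/
def IndependentOf (S : Set ι) (x : Grassmann F ι) : Prop :=
  x ∈ Algebra.adjoin F ((gen : ι → Grassmann F ι) '' Sᶜ)

/-- The left derivative with respect to the generator with index `i`: the `F`-linear map that sends
`1` to `0` and `v * x` to `(coefficient of v at i) • x - v * ∂ᵢ x` for `v` of degree one. -/
def leftDeriv (i : ι) : Grassmann F ι →ₗ[F] Grassmann F ι :=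
  CliffordAlgebra.contractLeft (Q := (0 : QuadraticForm F (ι →₀ F))) (Finsupp.lapply i)

/-- The Berezin integral over the generator with index `i`, i.e. the right derivative.
The lemmas `berezin_one`, `berezin_gen_self`, `berezin_mul` below are its defining properties. -/
def berezin (i : ι) : Grassmann F ι →ₗ[F] Grassmann F ι :=
  (CliffordAlgebra.contractRight (Q := (0 : QuadraticForm F (ι →₀ F)))).flip (Finsupp.lapply i)

/-- The multiple integral `∫ x dx₁ dx₂ ⋯ dxₙ`, as an iterated one: first over `x₁`, then over
`x₂`, and so on. -/
def berezinIter (l : List ι) (x : Grassmann F ι) : Grassmann F ι :=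
  l.foldl (fun y i => berezin i y) x

theorem berezin_one (i : ι) : berezin i (1 : Grassmann F ι) = 0 :=
  CliffordAlgebra.contractRight_one (0 : QuadraticForm F (ι →₀ F)) (Finsupp.lapply i)

theorem berezin_gen_self (i : ι) : berezin i (gen i : Grassmann F ι) = 1 := by
  refine (CliffordAlgebra.contractRight_ι (0 : QuadraticForm F (ι →₀ F)) (Finsupp.lapply i) _).trans ?_
  simp

theorem berezin_mul (i : ι) (g h : Grassmann F ι) (hg : IndependentOf {i} g) :
    berezin i (g * h) = g * berezin i h := by
  have key : ∀ (j : ι), j ≠ i → ∀ h : Grassmann F ι,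
      berezin i (gen j * h) = gen j * berezin i h := by
    intro j hj h
    induction h using CliffordAlgebra.right_induction with
    | algebraMap r =>
      have h1 : berezin i (gen j : Grassmann F ι) = 0 := by
        refine (CliffordAlgebra.contractRight_ι (0 : QuadraticForm F (ι →₀ F))
          (Finsupp.lapply i) _).trans ?_
        simp [hj]
      have h2 : berezin i (algebraMap F (Grassmann F ι) r) = 0 :=
        CliffordAlgebra.contractRight_algebraMap (0 : QuadraticForm F (ι →₀ F)) (Finsupp.lapply i) r
      have h3 : (gen j : Grassmann F ι) * algebraMap F _ r = r • gen j := by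
        rw [Algebra.smul_def, Algebra.commutes]
      erw [h2, h3]
      simp [h1]
    | add x y hx hy =>
      have e1 := map_add (berezin i) (gen j * x) (gen j * y)
      rw [← mul_add, hx, hy, ← mul_add] at e1
      rw [e1, map_add]
    | mul_ι v x hx =>
      have e1 := CliffordAlgebra.contractRight_mul_ι (Q := (0 : QuadraticForm F (ι →₀ F)))
        (d := Finsupp.lapply i) v (gen j * x)
      have e2 := CliffordAlgebra.contractRight_mul_ι (Q := (0 : QuadraticForm F (ι →₀ F)))
        (d := Finsupp.lapply i) v x
      change berezin i ((gen j * x) * CliffordAlgebra.ι _ v) = _ - berezin i (gen j * x) * _ at e1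
      change berezin i (x * CliffordAlgebra.ι _ v) = _ - berezin i x * _ at e2
      rw [hx] at e1
      rw [← mul_assoc, e1, e2, mul_sub, mul_assoc, mul_smul_comm]
  unfold IndependentOf at hg
  induction hg using Algebra.adjoin_induction generalizing h with
  | mem x hx =>
    obtain ⟨j, hj, rfl⟩ := hx
    exact key j hj h
  | algebraMap r => rw [← Algebra.smul_def, map_smul, Algebra.smul_def]
  | add x y _ _ hx hy => rw [add_mul, map_add, hx, hy, add_mul]
  | mul x y _ _ hx hy => rw [mul_assoc, hx, hy, mul_assoc]

/-- `w` is a possible value of `d⁻¹ 1`. -/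
def IsInverseOne (d : Grassmann F ι →ₗ[F] Grassmann F ι) (w : Grassmann F ι) : Prop :=
  IsHomogeneous w ∧ d w = 1

end Grassmann

/-! ## Clusters of 4-simplices, orientations and links

Vertices are natural numbers, a simplex is the set of its vertices, and a cluster (one side of a
Pachner move) is a finite set of 4-simplices. -/

/-- The vertices of a cluster. -/
def vertices (C : Finset (Finset ℕ)) : Finset ℕ :=
  C.biUnion id

/-- The number of inversions of a list; an ordering of the vertices of a simplex
is an even permutation of the increasing one if and only if this number is even. -/
def inversions : List ℕ → ℕ
  | [] => 0
  | x :: xs => (xs.filter (fun y => y < x)).length + inversions xs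

/-- Orientations are given by signs with respect to the increasing order of vertices: `ε u = 1` if
the 4-simplex `u` is oriented by the increasing order of its vertices and `ε u = -1` otherwise.
This is the coefficient at the tetrahedron `t` in the simplicial boundary of the oriented
4-chain of all simplices of `C` (up to an overall sign that does not depend on `C`, `t`: the
missing vertex `v` stands at place number `#{x ∈ t | x < v}`). -/
def boundaryCoeff (ε : Finset ℕ → ℤˣ) (C : Finset (Finset ℕ)) (t : Finset ℕ) : ℤ :=
  ∑ v ∈ vertices C with v ∉ t ∧ insert v t ∈ C,
    (ε (insert v t) : ℤ) * (-1) ^ (t.filter (fun x => x < v)).card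

/-- `ε` is a consistent orientation of all 4-simplices of the two sides `L`, `R` of a Pachner move,
the same in both sides: the oriented boundaries coincide. In particular, contributions to a
tetrahedron that is inner for one side (so that it is absent from the other) cancel. -/
def IsConsistentOrientation (ε : Finset ℕ → ℤˣ) (L R : Finset (Finset ℕ)) : Prop :=
  ∀ t : Finset ℕ, t.card = 4 → boundaryCoeff ε L t = boundaryCoeff ε R t

/-- The oriented link of the 2-face `klm` in the cluster `C`: the oriented edges `(i, j)` such that
`ijklm` is a 4-simplex of `C` whose orientation is the one given by the order `i, j, k, l, m`. -/
def orientedLink (ε : Finset ℕ → ℤˣ) (C : Finset (Finset ℕ)) (k l m : ℕ) : Finset (ℕ × ℕ) :=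
  (vertices C ×ˢ vertices C).filter fun p =>
    [p.1, p.2, k, l, m].Nodup ∧ ({p.1, p.2, k, l, m} : Finset ℕ) ∈ C ∧
      ε {p.1, p.2, k, l, m} = (-1) ^ inversions [p.1, p.2, k, l, m]

/-- The tetrahedra of a cluster, written as increasing quadruples of vertices. -/
def tetrahedra (C : Finset (Finset ℕ)) : Finset (ℕ × ℕ × ℕ × ℕ) :=
  (vertices C ×ˢ vertices C ×ˢ vertices C ×ˢ vertices C).filter fun q =>
    (q.1 < q.2.1 ∧ q.2.1 < q.2.2.1 ∧ q.2.2.1 < q.2.2.2) ∧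
      ∃ u ∈ C, ({q.1, q.2.1, q.2.2.1, q.2.2.2} : Finset ℕ) ⊆ u

/-! ## Weights -/

/-- Indices of Grassmann generators: `a t` and `b t` for every tetrahedron `t` (given by the set of
its vertices), and any further set `κ` of generators, not attached to simplices. -/
inductive Gen (κ : Type*) where
  | a (t : Finset ℕ) : Gen κ
  | b (t : Finset ℕ) : Gen κ
  | extra (c : κ) : Gen κ

section Weights

variable {F : Type*} [Field F] {κ : Type*}

/-- The generator `a_{ijkl}`. -/
def ga (i j k l : ℕ) : Grassmann F (Gen κ) := gen (Gen.a {i, j, k, l})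

/-- The generator `b_{ijkl}`. -/
def gb (i j k l : ℕ) : Grassmann F (Gen κ) := gen (Gen.b {i, j, k, l})

/-- The undeformed weight of the 4-simplex with vertices `i < j < k < l < m`. -/
def weight (ζ : ℕ → F) (i j k l m : ℕ) : Grassmann F (Gen κ) :=
  (ζ l - ζ m)⁻¹ •
    (((ζ k - ζ l) • ga i j k l - (ζ k - ζ m) • ga i j k m
        + (ζ l - ζ m) • ga i j l m - (ζ l - ζ m) • ga i k l m)
    * ((ζ k - ζ l) • gb i j k l - (ζ k - ζ m) • gb i j k m
        + (ζ l - ζ m) • gb i j l m + (ζ l - ζ m) • ga j k l m)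
    * (-(ζ i - ζ l) • ga i j k l - (ζ j - ζ l) • gb i j k l
        + (ζ i - ζ m) • ga i j k m + (ζ j - ζ m) • gb i j k m
        - (ζ l - ζ m) • gb i k l m + (ζ l - ζ m) • gb j k l m))

/-- The deformed weight of the 4-simplex with vertices `i < j < k < l < m`. -/
def deformedWeight (ζ : ℕ → F) (α : Finset ℕ → Grassmann F (Gen κ)) (e : Grassmann F (Gen κ))
    (i j k l m : ℕ) : Grassmann F (Gen κ) :=
  weight ζ i j k l m + α {i, j, k, l, m} * e

/-- The link relations on the `α`'s for all 2-faces `klm` of the two sides `L`, `R`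
of a Pachner move. -/
def LinkRelations (ζ : ℕ → F) (ε : Finset ℕ → ℤˣ) (L R : Finset (Finset ℕ))
    (α : Finset ℕ → Grassmann F (Gen κ)) : Prop :=
  ∀ k l m : ℕ, k < l → l < m → (∃ u ∈ L ∪ R, ({k, l, m} : Finset ℕ) ⊆ u) →
    ∑ p ∈ orientedLink ε L k l m, (ζ p.1 - ζ p.2) • α {p.1, p.2, k, l, m} =
      ∑ p ∈ orientedLink ε R k l m, (ζ p.1 - ζ p.2) • α {p.1, p.2, k, l, m}

/-- The operator `d_{t,s}` for the tetrahedron `t` with vertices `i < j < k < l` and its 2-face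
`s`. -/
def tetFaceOp (ζ : ℕ → F) (i j k l : ℕ) (s : Finset ℕ) :
    Grassmann F (Gen κ) →ₗ[F] Grassmann F (Gen κ) :=
  if s = {i, j, k} then
    ((ζ j - ζ k) / (ζ k - ζ l)) • leftDeriv (Gen.a {i, j, k, l})
      - ((ζ i - ζ k) / (ζ k - ζ l)) • leftDeriv (Gen.b {i, j, k, l})
  else if s = {i, j, l} then
    -((ζ j - ζ l) / (ζ k - ζ l)) • leftDeriv (Gen.a {i, j, k, l})
      + ((ζ i - ζ l) / (ζ k - ζ l)) • leftDeriv (Gen.b {i, j, k, l})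
  else if s = {i, k, l} then leftDeriv (Gen.a {i, j, k, l})
  else if s = {j, k, l} then -leftDeriv (Gen.b {i, j, k, l})
  else 0

/-- The operator `d_s` for a 2-face `s` of the cluster `C`: the sum of `d_{t,s}` over all
tetrahedra `t ⊃ s` of `C`. -/
def faceOp (ζ : ℕ → F) (C : Finset (Finset ℕ)) (s : Finset ℕ) :
    Grassmann F (Gen κ) →ₗ[F] Grassmann F (Gen κ) :=
  ∑ q ∈ tetrahedra C with s ⊆ {q.1, q.2.1, q.2.2.1, q.2.2.2},
    tetFaceOp ζ q.1 q.2.1 q.2.2.1 q.2.2.2 s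

end Weights

/-! ## The move 3 → 3 -/

/-- The left-hand side of the move 3 → 3. -/
def lhs33 : Finset (Finset ℕ) := {{1, 2, 3, 4, 5}, {1, 2, 3, 4, 6}, {1, 2, 3, 5, 6}}

/-- The right-hand side of the move 3 → 3. -/
def rhs33 : Finset (Finset ℕ) := {{1, 2, 4, 5, 6}, {1, 3, 4, 5, 6}, {2, 3, 4, 5, 6}}

/-- The integration variables in the left-hand side, in the order of integration. -/
def lhsVars (κ : Type*) : List (Gen κ) :=
  [.a {1, 2, 3, 4}, .b {1, 2, 3, 4}, .a {1, 2, 3, 5}, .b {1, 2, 3, 5},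
    .a {1, 2, 3, 6}, .b {1, 2, 3, 6}]

/-- The integration variables in the right-hand side, in the order of integration. -/
def rhsVars (κ : Type*) : List (Gen κ) :=
  [.a {1, 4, 5, 6}, .b {1, 4, 5, 6}, .a {2, 4, 5, 6}, .b {2, 4, 5, 6},
    .a {3, 4, 5, 6}, .b {3, 4, 5, 6}]

/-- The integration variables of both sides. -/
def innerVars (κ : Type*) : Set (Gen κ) :=
  {v | v ∈ lhsVars κ ∨ v ∈ rhsVars κ}

end Pachner

end

/-!
Write `ζᵢⱼ = ζᵢ - ζⱼ`. Each weight is a scalar times a product of three vectors (elements of degree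
one), so its integrals are governed by linear algebra: in a product of vectors a factor may be
changed by a linear combination of the other factors (`prodι_set`), and if a variable occurs in one
factor only, integration over it removes that factor (`berezinIter_cons_prodι`).

*Face weights.* A homogeneous `w` with `d w = 1` is a vector, because `d` is a contraction and
lowers degrees by one (`IsInverseOne.exists_ι`). All weights are polynomials in vectors annihilated
by the functional that defines `d`, and therefore the integral of a product of weights and `w` does
not depend on the choice of `w` (`berezinIter_mul_ι_congr`). So `w` may be chosen anew in each of
the integrals below.

*Outer vectors.* On the left-hand side the three factors of the weight of `123pq` are differences of
vectors attached to the tetrahedra `123p` and `123q`, plus `ζ_pq` times the outer vectors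
`u_pq = a_12pq - a_13pq`, `v_pq = b_12pq + a_23pq`, `w_pq = b_23pq - b_13pq`. Hence the alternating
sum of the corresponding factors over `45`, `46`, `56` is free of inner variables: it is
`∂x = ζ₄₅ x₄₅ - ζ₄₆ x₄₆ + ζ₅₆ x₅₆` for `x = u, v, w`. On the right-hand side the same three vectors
arise from pairs of simplices with a common inner tetrahedron. With
`T_pq = ζ_1q u_pq + ζ_2q v_pq + ζ_3q w_pq`, row reduction gives the integrals of two weights:
`T_pr - T_pq` for the simplices `123pq`, `123pr` (`berezinIter_lhs`), and `-∂u`, `∂v`, `-∂w` for the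
three pairs on the right (`berezinIter_rhs`).

*Comparison.* As `e * e = 0`, the product of three deformed weights consists of the undeformed
product and of three terms with one factor `α e` (`mul_deformed`). In the undeformed product the
factors of the third weight can be replaced by outer vectors, which reduces it to an integral of
two weights; both sides become `ζ₅₆⁻¹ ∂u ∂v ∂w (T₄₆ - T₄₅)` (`berezinIter_weights`). In the terms
with `α e`, the coefficients of `u_pq`, `v_pq`, `w_pq` on the two sides agree by the link relation
of the face `jkr`, where `{p, q, r} = {4, 5, 6}` and `jk` is `23`, `13`, `12`, respectively
(`LinkRelations.eq`).
-/

noncomputable section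

namespace Pachner

/-! ### Products of vectors and their integrals -/

section Algebra

variable {F : Type*} [Field F] {I : Type*}

/-- The product of the elements of degree one given by a list of vectors. -/
def prodι (l : List (I →₀ F)) : Grassmann F I :=
  (l.map (ExteriorAlgebra.ι F)).prod

@[simp] theorem prodι_nil : prodι ([] : List (I →₀ F)) = 1 := rfl

@[simp] theorem prodι_cons (v : I →₀ F) (l : List (I →₀ F)) :
    prodι (v :: l) = ExteriorAlgebra.ι F v * prodι l := by simp [prodι]

@[simp] theorem prodι_append (l l' : List (I →₀ F)) :
    prodι (l ++ l') = prodι l * prodι l' := by simp [prodι]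

theorem smul_prodι_mul_smul_prodι_mul_ι (c d : F) (l l' : List (I →₀ F)) (v : I →₀ F) :
    c • prodι l * d • prodι l' * ExteriorAlgebra.ι F v = (c * d) • prodι (l ++ l' ++ [v]) := by
  rw [smul_mul_smul_comm, smul_mul_assoc, prodι_append, prodι_append, prodι_cons, prodι_nil,
    mul_one]

theorem ι_mul_ι_swap (v w : I →₀ F) :
    ExteriorAlgebra.ι F v * ExteriorAlgebra.ι F w =
      -(ExteriorAlgebra.ι F w * ExteriorAlgebra.ι F v) :=
  eq_neg_of_add_eq_zero_left (ExteriorAlgebra.ι_add_mul_swap v w)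

theorem ι_mul_prodι (v : I →₀ F) (l : List (I →₀ F)) :
    ExteriorAlgebra.ι F v * prodι l =
      (-1 : F) ^ l.length • (prodι l * ExteriorAlgebra.ι F v) := by
  induction l with
  | nil => simp
  | cons w l ih =>
    rw [prodι_cons, ← mul_assoc, ι_mul_ι_swap, neg_mul, mul_assoc, ih, mul_smul_comm,
      List.length_cons, pow_succ, mul_assoc, mul_neg_one, neg_smul]

theorem ι_mul_prodι_of_mem {v : I →₀ F} {l : List (I →₀ F)} (h : v ∈ l) :
    ExteriorAlgebra.ι F v * prodι l = 0 := by
  induction l with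
  | nil => simp at h
  | cons w l ih =>
    rw [prodι_cons, ← mul_assoc]
    rcases List.mem_cons.1 h with rfl | h
    · rw [ExteriorAlgebra.ι_sq_zero, zero_mul]
    · rw [ι_mul_ι_swap, neg_mul, mul_assoc, ih h, mul_zero, neg_zero]

theorem prodι_mul_ι_of_mem {v : I →₀ F} {l : List (I →₀ F)} (h : v ∈ l) :
    prodι l * ExteriorAlgebra.ι F v = 0 := by
  have h1 := ι_mul_prodι_of_mem h
  rw [ι_mul_prodι] at h1
  exact (smul_eq_zero.1 h1).resolve_left (pow_ne_zero _ (by norm_num))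

/-- A factor of a product of elements of degree one matters only modulo the span of the others. -/
theorem prodι_replace (l l' : List (I →₀ F)) (v v' : I →₀ F)
    (h : v - v' ∈ Submodule.span F {x | x ∈ l ++ l'}) :
    prodι (l ++ v :: l') = prodι (l ++ v' :: l') := by
  have key : ∀ x ∈ Submodule.span F {x | x ∈ l ++ l'},
      prodι l * ExteriorAlgebra.ι F x * prodι l' = 0 := by
    intro x hx
    induction hx using Submodule.span_induction with
    | mem x hx =>
      rcases List.mem_append.1 hx with hx | hx
      · rw [prodι_mul_ι_of_mem hx, zero_mul]
      · rw [mul_assoc, ι_mul_prodι_of_mem hx, mul_zero]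
    | zero => simp
    | add x y _ _ hx hy => rw [map_add, mul_add, add_mul, hx, hy, add_zero]
    | smul c x _ hx => rw [map_smul, mul_smul_comm, smul_mul_assoc, hx, smul_zero]
  have := key _ h
  rw [map_sub, mul_sub, sub_mul, sub_eq_zero] at this
  simpa only [prodι_append, prodι_cons, mul_assoc] using this

/-- The form of `prodι_replace` for computations: the factor number `n` of `prodι k` changes by
a linear combination of the other factors, with coefficients given by the list `c`. -/
theorem prodι_set (k : List (I →₀ F)) (n : ℕ) (hn : n < k.length) (v : I →₀ F) (c : List F)
    (h : k[n] - v = (List.zipWith (· • ·) c (k.eraseIdx n)).sum) :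
    prodι k = prodι (k.set n v) := by
  have hsum : ∀ (l : List (I →₀ F)) (c : List F),
      (List.zipWith (· • ·) c l).sum ∈ Submodule.span F {x | x ∈ l} := by
    intro l c
    refine list_sum_mem fun x hx => ?_
    obtain ⟨m, hm, rfl⟩ := List.getElem_of_mem hx
    rw [List.getElem_zipWith]
    exact Submodule.smul_mem _ _ (Submodule.subset_span (List.getElem_mem _))
  have e : k = k.take n ++ k[n] :: k.drop (n + 1) := by simp
  rw [List.set_eq_take_append_cons_drop, if_pos hn]
  conv_lhs => rw [e]
  refine prodι_replace _ _ _ _ ?_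
  rw [h, ← List.eraseIdx_eq_take_drop_succ]
  exact hsum _ _

theorem berezin_mul_ι (i : I) (x : Grassmann F I) (v : I →₀ F) :
    berezin i (x * ExteriorAlgebra.ι F v) = v i • x - berezin i x * ExteriorAlgebra.ι F v :=
  CliffordAlgebra.contractRight_mul_ι (Q := (0 : QuadraticForm F (I →₀ F)))
    (d := Finsupp.lapply i) v x

theorem berezin_ι (i : I) (v : I →₀ F) :
    berezin i (ExteriorAlgebra.ι F v : Grassmann F I) = algebraMap F _ (v i) :=
  CliffordAlgebra.contractRight_ι (0 : QuadraticForm F (I →₀ F)) (Finsupp.lapply i) v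

theorem berezin_prodι_cons (i : I) (v : I →₀ F) (l : List (I →₀ F)) :
    berezin i (prodι (v :: l)) =
      ExteriorAlgebra.ι F v * berezin i (prodι l) + ((-1) ^ l.length * v i) • prodι l := by
  induction l using List.reverseRecOn with
  | nil =>
    simp [berezin_ι, berezin_one, Algebra.algebraMap_eq_smul_one]
  | append_singleton l w ih =>
    have e1 : prodι (l ++ [w]) = prodι l * ExteriorAlgebra.ι F w := by simp
    have e2 : prodι (v :: (l ++ [w])) = prodι (v :: l) * ExteriorAlgebra.ι F w := by
      simp [mul_assoc]
    rw [e2, berezin_mul_ι, ih, e1, berezin_mul_ι, prodι_cons, List.length_append, pow_add]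
    simp only [mul_sub, add_mul, mul_smul_comm, smul_mul_assoc, mul_assoc, List.length_singleton,
      pow_one]
    module

theorem berezin_prodι_eq_zero (i : I) (l : List (I →₀ F)) (h : ∀ w ∈ l, w i = 0) :
    berezin i (prodι l) = 0 := by
  induction l with
  | nil => rw [prodι_nil, berezin_one]
  | cons w l ih =>
    rw [berezin_prodι_cons, ih fun w hw => h w (List.mem_cons_of_mem _ hw), h w (by simp)]
    simp

/-- If the variable `i` occurs in one factor only, then integration over it removes this factor. -/
theorem berezin_prodι (i : I) (l l' : List (I →₀ F)) (v : I →₀ F)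
    (h : ∀ w ∈ l ++ l', w i = 0) :
    berezin i (prodι (l ++ v :: l')) = ((-1) ^ l'.length * v i) • prodι (l ++ l') := by
  induction l with
  | nil =>
    rw [List.nil_append, berezin_prodι_cons, berezin_prodι_eq_zero i l' (by simpa using h),
      mul_zero, zero_add, List.nil_append]
  | cons w l ih =>
    rw [List.cons_append, berezin_prodι_cons, ih fun w hw => h w (List.mem_cons_of_mem _ hw),
      h w (by simp), mul_zero, zero_smul, add_zero, List.cons_append, prodι_cons, mul_smul_comm]

theorem berezin_prodι_eraseIdx (i : I) (k : List (I →₀ F)) (n : ℕ) (hn : n < k.length)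
    (h : ∀ w ∈ k.eraseIdx n, w i = 0) :
    berezin i (prodι k) = ((-1) ^ (k.length - (n + 1)) * k[n] i) • prodι (k.eraseIdx n) := by
  have e : k = k.take n ++ k[n] :: k.drop (n + 1) := by simp
  rw [List.eraseIdx_eq_take_drop_succ] at h ⊢
  have := berezin_prodι i _ _ k[n] h
  rwa [← e, List.length_drop] at this

theorem berezin_comm (i j : I) (x : Grassmann F I) :
    berezin i (berezin j x) = -berezin j (berezin i x) :=
  CliffordAlgebra.contractRight_comm (Q := (0 : QuadraticForm F (I →₀ F))) _ _ x

theorem berezin_pair_comm (i j k l : I) (x : Grassmann F I) :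
    berezin i (berezin j (berezin k (berezin l x))) =
      berezin k (berezin l (berezin i (berezin j x))) := by
  rw [berezin_comm j k, map_neg, berezin_comm i k, neg_neg, berezin_comm j l, map_neg,
    berezin_comm i l, neg_neg]

theorem berezinIter_cons (i : I) (l : List I) (x : Grassmann F I) :
    berezinIter (i :: l) x = berezinIter l (berezin i x) := rfl

theorem berezinIter_zero (l : List I) : berezinIter l (0 : Grassmann F I) = 0 := by
  induction l with
  | nil => rfl
  | cons i l ih =>
    rw [berezinIter_cons, map_zero, ih]

theorem berezinIter_neg (l : List I) (x : Grassmann F I) :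
    berezinIter l (-x) = -berezinIter l x := by
  induction l generalizing x with
  | nil => rfl
  | cons i l ih =>
    rw [berezinIter_cons, map_neg, ih, berezinIter_cons]

theorem berezinIter_add (l : List I) (x y : Grassmann F I) :
    berezinIter l (x + y) = berezinIter l x + berezinIter l y := by
  induction l generalizing x y with
  | nil => rfl
  | cons i l ih =>
    rw [berezinIter_cons, map_add, ih, berezinIter_cons, berezinIter_cons]

theorem berezinIter_smul (l : List I) (c : F) (x : Grassmann F I) :
    berezinIter l (c • x) = c • berezinIter l x := by
  induction l generalizing x with
  | nil => rfl
  | cons i l ih =>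
    rw [berezinIter_cons, map_smul, ih, berezinIter_cons]

theorem berezinIter_swap (i j k l : I) (L : List I) (x : Grassmann F I) :
    berezinIter (i :: j :: k :: l :: L) x = berezinIter (k :: l :: i :: j :: L) x := by
  simp only [berezinIter_cons]
  rw [berezin_pair_comm l k j i]

/-- If the first integration variable occurs in the factor number `n` only, then the integration
over it removes this factor. -/
theorem berezinIter_cons_prodι {i : I} {l : List I} {k : List (I →₀ F)} (n : ℕ) (hn : n < k.length)
    (h : ∀ w ∈ k.eraseIdx n, w i = 0) :
    berezinIter (i :: l) (prodι k) =
      ((-1) ^ (k.length - (n + 1)) * k[n] i) • berezinIter l (prodι (k.eraseIdx n)) := by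
  rw [berezinIter_cons, berezin_prodι_eraseIdx i k n hn h, berezinIter_smul]

theorem IndependentOf.mono {S T : Set I} (h : S ⊆ T) {x : Grassmann F I}
    (hx : IndependentOf T x) : IndependentOf S x :=
  Algebra.adjoin_mono (Set.image_mono (Set.compl_subset_compl.2 h)) hx

theorem independentOf_ι {S : Set I} {v : I →₀ F} (hv : ∀ i ∈ S, v i = 0) :
    IndependentOf S (ExteriorAlgebra.ι F v) := by
  rw [← Finsupp.sum_single v, map_finsuppSum]
  refine Subalgebra.sum_mem _ fun i hi => ?_
  have h : Finsupp.single i (v i) = v i • Finsupp.single i (1 : F) := by simp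
  change ExteriorAlgebra.ι F (Finsupp.single i (v i)) ∈ _
  rw [h, map_smul]
  have hm : gen i ∈ Algebra.adjoin F ((gen : I → Grassmann F I) '' Sᶜ) :=
    Algebra.subset_adjoin ⟨i, fun hS => Finsupp.mem_support_iff.1 hi (hv i hS), rfl⟩
  exact Subalgebra.smul_mem _ hm _

theorem berezinIter_mul (l : List I) (g x : Grassmann F I) (hg : IndependentOf {i | i ∈ l} g) :
    berezinIter l (g * x) = g * berezinIter l x := by
  induction l generalizing x with
  | nil => rfl
  | cons i l ih =>
    have mono : ∀ {S T : Set I}, S ⊆ T → IndependentOf T g → IndependentOf S g := fun h hT =>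
      Algebra.adjoin_mono (Set.image_mono (Set.compl_subset_compl.2 h)) hT
    rw [berezinIter_cons, berezin_mul i g x (mono (by simp) hg),
      ih _ (mono (fun j hj => by simp_all) hg), berezinIter_cons]

end Algebra

/-! ### Integrals of seven linear factors -/

section Integrals

variable {F : Type*} [Field F] {I : Type*}

/-- Integration of the product of the factors of the weights of `123pq` and `123pr` and the vector
`a_123p`. The arguments `X 0, …, X 5` stand for the vectors `a` and `b` of the tetrahedra `123p`,
`123q`, `123r`, in this order, and `x` for the corresponding variables. -/
theorem berezinIter_lhsPair (x : Fin 6 → I) (X : Fin 6 → (I →₀ F))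
    (hX : ∀ n m, X n (x m) = if n = m then 1 else 0) (z₁ z₂ z₃ p q r : F)
    (h₂₃ : z₂ - z₃ ≠ 0) (hpq : p - q ≠ 0)
    (hq : z₃ - q ≠ 0) (hr : z₃ - r ≠ 0) (u v w u' v' w' : I →₀ F)
    (hu : ∀ n, u (x n) = 0) (hv : ∀ n, v (x n) = 0) (hw : ∀ n, w (x n) = 0)
    (hu' : ∀ n, u' (x n) = 0) (hv' : ∀ n, v' (x n) = 0) (hw' : ∀ n, w' (x n) = 0) :
    berezinIter [x 0, x 1, x 2, x 3, x 4, x 5] (prodι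
      [(z₃ - p) • X 0 - (z₃ - q) • X 2 + (p - q) • u,
       (z₃ - p) • X 1 - (z₃ - q) • X 3 + (p - q) • v,
       -(z₁ - p) • X 0 - (z₂ - p) • X 1 + (z₁ - q) • X 2 + (z₂ - q) • X 3 + (p - q) • w,
       (z₃ - p) • X 0 - (z₃ - r) • X 4 + (p - r) • u',
       (z₃ - p) • X 1 - (z₃ - r) • X 5 + (p - r) • v',
       -(z₁ - p) • X 0 - (z₂ - p) • X 1 + (z₁ - r) • X 4 + (z₂ - r) • X 5 + (p - r) • w',
       X 0]) =
    ((z₂ - z₃) * (z₃ - q) * (z₃ - r) * (p - q) * (p - r)) •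
      (ExteriorAlgebra.ι F (((z₁ - r) • u' + (z₂ - r) • v' + (z₃ - r) • w')
        - ((z₁ - q) • u + (z₂ - q) • v + (z₃ - q) • w)) : Grassmann F I) := by
  set f₁ := (z₃ - p) • X 0 - (z₃ - q) • X 2 + (p - q) • u with hf₁
  set f₂ := (z₃ - p) • X 1 - (z₃ - q) • X 3 + (p - q) • v with hf₂
  set f₃ := -(z₁ - p) • X 0 - (z₂ - p) • X 1 + (z₁ - q) • X 2 + (z₂ - q) • X 3
    + (p - q) • w with hf₃
  set g₁ := (z₃ - p) • X 0 - (z₃ - r) • X 4 + (p - r) • u' with hg₁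
  set g₂ := (z₃ - p) • X 1 - (z₃ - r) • X 5 + (p - r) • v' with hg₂
  set g₃ := -(z₁ - p) • X 0 - (z₂ - p) • X 1 + (z₁ - r) • X 4 + (z₂ - r) • X 5
    + (p - r) • w' with hg₃
  set t := (z₁ - q) • u + (z₂ - q) • v + (z₃ - q) • w with ht
  set t' := (z₁ - r) • u' + (z₂ - r) • v' + (z₃ - r) • w' with ht'
  -- The variables of `X 2` and `X 3` cancel in this combination of `f₁`, `f₂`, `f₃`; modulo `X 0`
  -- it depends on inner variables through `X 1` only.
  rw [prodι_set [f₁, f₂, f₃, g₁, g₂, g₃, X 0] 2 (by simp)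
    (((p - q) / (z₃ - q)) • (t - (z₂ - z₃) • X 1))
    [-(z₁ - q) / (z₃ - q), -(z₂ - q) / (z₃ - q), 0, 0, 0, -(z₁ - z₃) * (p - q) / (z₃ - q)]
    (by simp [f₁, f₂, f₃, t]; match_scalars <;> field_simp <;> ring)]
  simp only [List.set_cons_succ, List.set_cons_zero]
  -- The same combination of `g₁`, `g₂`, `g₃`; now `X 1` cancels against the third factor.
  rw [prodι_set _ 5 (by simp) (((p - r) / (z₃ - r)) • (t' - t))
    [0, 0, (z₃ - q) * (p - r) / ((p - q) * (z₃ - r)), -(z₁ - r) / (z₃ - r), -(z₂ - r) / (z₃ - r),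
      -(z₁ - z₃) * (p - r) / (z₃ - r)]
    (by simp [g₁, g₂, g₃, t, t']; match_scalars <;> field_simp <;> ring)]
  simp only [List.set_cons_succ, List.set_cons_zero]
  -- Each of the remaining factors is reduced to one inner variable.
  rw [prodι_set _ 0 (by simp) (-(z₃ - q) • X 2 + (p - q) • u)
    [0, 0, 0, 0, 0, z₃ - p]
    (by simp [f₁]; module),
    prodι_set _ 3 (by simp) (-(z₃ - r) • X 4 + (p - r) • u')
    [0, 0, 0, 0, 0, z₃ - p]
    (by simp [g₁]; module),
    prodι_set _ 1 (by simp) (-(z₃ - q) • X 3 + (p - q) • v + ((z₃ - p) / (z₂ - z₃)) • t)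
    [0, -(z₃ - p) * (z₃ - q) / ((p - q) * (z₂ - z₃))]
    (by simp [f₂]; match_scalars <;> field_simp <;> ring),
    prodι_set _ 4 (by simp) (-(z₃ - r) • X 5 + (p - r) • v' + ((z₃ - p) / (z₂ - z₃)) • t)
    [0, 0, -(z₃ - p) * (z₃ - q) / ((p - q) * (z₂ - z₃))]
    (by simp [g₂]; match_scalars <;> field_simp <;> ring)]
  simp only [List.set_cons_succ, List.set_cons_zero]
  have ht0 : ∀ n, t (x n) = 0 := fun n => by simp [t, *]
  have ht0' : ∀ n, t' (x n) = 0 := fun n => by simp [t', *]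
  clear_value t t'
  rw [berezinIter_cons_prodι 6 (by simp) (by simp [*])]
  simp only [List.eraseIdx_cons_zero, List.eraseIdx_cons_succ]
  rw [berezinIter_cons_prodι 2 (by simp) (by simp [*])]
  simp only [List.eraseIdx_cons_zero, List.eraseIdx_cons_succ]
  rw [berezinIter_cons_prodι 0 (by simp) (by simp [*])]
  simp only [List.eraseIdx_cons_zero]
  rw [berezinIter_cons_prodι 0 (by simp) (by simp [*])]
  simp only [List.eraseIdx_cons_zero]
  rw [berezinIter_cons_prodι 0 (by simp) (by simp [*])]
  simp only [List.eraseIdx_cons_zero]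
  rw [berezinIter_cons_prodι 0 (by simp) (by simp [*])]
  simp only [List.eraseIdx_cons_zero]
  simp [berezinIter, *]
  match_scalars <;> field_simp <;> ring

/-- Integration of the product of the factors of two weights of the right-hand side with a common
inner tetrahedron, whose variables are `x 0` and `x 1`, and of a face weight. -/
theorem berezinIter_rhsPair (x : Fin 6 → I) (X : Fin 6 → (I →₀ F))
    (hX : ∀ n m, X n (x m) = if n = m then 1 else 0) (c : F)
    (u v w u' v' w' : I →₀ F)
    (hu : ∀ n, u (x n) = 0) (hv : ∀ n, v (x n) = 0) (hw : ∀ n, w (x n) = 0)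
    (hu' : ∀ n, u' (x n) = 0) (hv' : ∀ n, v' (x n) = 0) (hw' : ∀ n, w' (x n) = 0) :
    berezinIter [x 0, x 1, x 2, x 3, x 4, x 5] (prodι
      [u - c • X 0, v + c • X 2, w - c • X 1 + c • X 3,
       u' - c • X 0, v' + c • X 4, w' - c • X 1 + c • X 5, -X 1]) =
    c ^ 5 • (ExteriorAlgebra.ι F (u' - u) : Grassmann F I) := by
  rw [prodι_set _ 3 (by simp) (u' - u) [1] (by simp),
    prodι_set _ 2 (by simp) (w + c • X 3) [0, 0, 0, 0, 0, c] (by simp),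
    prodι_set _ 5 (by simp) (w' + c • X 5) [0, 0, 0, 0, 0, c] (by simp)]
  simp only [List.set_cons_succ, List.set_cons_zero]
  rw [berezinIter_cons_prodι 0 (by simp) (by simp [*])]
  simp only [List.eraseIdx_cons_zero]
  rw [berezinIter_cons_prodι 5 (by simp) (by simp [*])]
  simp only [List.eraseIdx_cons_zero, List.eraseIdx_cons_succ]
  rw [berezinIter_cons_prodι 0 (by simp) (by simp [*])]
  simp only [List.eraseIdx_cons_zero]
  rw [berezinIter_cons_prodι 0 (by simp) (by simp [*])]
  simp only [List.eraseIdx_cons_zero]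
  rw [berezinIter_cons_prodι 1 (by simp) (by simp [*])]
  simp only [List.eraseIdx_cons_zero, List.eraseIdx_cons_succ]
  rw [berezinIter_cons_prodι 1 (by simp) (by simp [*])]
  simp only [List.eraseIdx_cons_zero, List.eraseIdx_cons_succ]
  simp [berezinIter, *]
  module

end Integrals

/-! ### Even and odd elements -/

section Parity

variable {F : Type*} [Field F] {I : Type*}

theorem IsEven.commute_ι {x : Grassmann F I} (hx : IsEven x) (v : I →₀ F) :
    x * ExteriorAlgebra.ι F v = ExteriorAlgebra.ι F v * x := by
  induction x, hx using CliffordAlgebra.even_induction with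
  | algebraMap r => exact Algebra.commutes _ _
  | add x y _ _ hx hy => rw [add_mul, mul_add, hx, hy]
  | ι_mul_ι_mul m₁ m₂ x _ hx =>
    change ExteriorAlgebra.ι F m₁ * ExteriorAlgebra.ι F m₂ * x * _ =
      _ * (ExteriorAlgebra.ι F m₁ * ExteriorAlgebra.ι F m₂ * x)
    rw [mul_assoc, hx, ← mul_assoc, ← mul_assoc, mul_assoc (ExteriorAlgebra.ι F m₁),
      ι_mul_ι_swap m₂ v, mul_neg, ← mul_assoc (ExteriorAlgebra.ι F m₁), ι_mul_ι_swap m₁ v]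
    simp only [mul_assoc, neg_mul, neg_neg]

theorem IsOdd.anticommute_ι {x : Grassmann F I} (hx : IsOdd x) (v : I →₀ F) :
    x * ExteriorAlgebra.ι F v = -(ExteriorAlgebra.ι F v * x) := by
  induction x, hx using CliffordAlgebra.odd_induction with
  | ι w => exact ι_mul_ι_swap _ _
  | add x y _ _ hx hy => rw [add_mul, mul_add, hx, hy, neg_add]
  | ι_mul_ι_mul m₁ m₂ x _ hx =>
    change ExteriorAlgebra.ι F m₁ * ExteriorAlgebra.ι F m₂ * x * _ =
      -(_ * (ExteriorAlgebra.ι F m₁ * ExteriorAlgebra.ι F m₂ * x))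
    rw [mul_assoc, hx, mul_neg, ← mul_assoc, ← mul_assoc, mul_assoc (ExteriorAlgebra.ι F m₁),
      ι_mul_ι_swap m₂ v, mul_neg, ← mul_assoc (ExteriorAlgebra.ι F m₁), ι_mul_ι_swap m₁ v]
    simp only [mul_assoc, neg_mul, neg_neg]

theorem IsEven.commute {x : Grassmann F I} (hx : IsEven x) (y : Grassmann F I) :
    x * y = y * x := by
  induction y using ExteriorAlgebra.induction with
  | algebraMap r => exact (Algebra.commutes _ _).symm
  | ι v => exact hx.commute_ι v
  | mul a b ha hb => rw [← mul_assoc, ha, mul_assoc, hb, mul_assoc]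
  | add a b ha hb => rw [mul_add, add_mul, ha, hb]

theorem IsOdd.anticommute {x y : Grassmann F I} (hx : IsOdd x) (hy : IsOdd y) :
    x * y = -(y * x) := by
  induction y, hy using CliffordAlgebra.odd_induction with
  | ι w => exact hx.anticommute_ι w
  | add a b _ _ ha hb => rw [mul_add, add_mul, ha, hb, neg_add]
  | ι_mul_ι_mul m₁ m₂ y _ hy =>
    change x * (ExteriorAlgebra.ι F m₁ * ExteriorAlgebra.ι F m₂ * y) =
      -(ExteriorAlgebra.ι F m₁ * ExteriorAlgebra.ι F m₂ * y * x)
    rw [← mul_assoc, ← mul_assoc, hx.anticommute_ι, neg_mul, mul_assoc _ x, hx.anticommute_ι,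
      mul_neg, neg_neg, ← mul_assoc, mul_assoc _ x, hy, mul_neg, mul_assoc _ y]

theorem IsOdd.mul_self (hF : ringChar F ≠ 2) {x : Grassmann F I} (hx : IsOdd x) : x * x = 0 := by
  have h2 : (2 : F) ≠ 0 := Ring.two_ne_zero hF
  have h := hx.anticommute hx
  have h' : (2 : F) • (x * x) = 0 := by
    rw [two_smul]
    nth_rewrite 1 [h]
    exact neg_add_cancel _
  exact (smul_eq_zero.1 h').resolve_left h2

theorem IsOdd.smul {x : Grassmann F I} (hx : IsOdd x) (c : F) : IsOdd (c • x) :=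
  Submodule.smul_mem _ c hx

theorem isOdd_ι_mul_ι_mul_ι (u v w : I →₀ F) : IsOdd (prodι [u, v, w]) := by
  have h1 := CliffordAlgebra.ι_mul_ι_mem_evenOdd_zero (0 : QuadraticForm F (I →₀ F)) u v
  have h2 := CliffordAlgebra.ι_mem_evenOdd_one (0 : QuadraticForm F (I →₀ F)) w
  have := CliffordAlgebra.evenOdd_mul_le (0 : QuadraticForm F (I →₀ F)) 0 1
    (Submodule.mul_mem_mul h1 h2)
  rw [zero_add, mul_assoc] at this
  rw [prodι_cons, prodι_cons, prodι_cons, prodι_nil, mul_one]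
  exact this

theorem IsOdd.mul {x y : Grassmann F I} (hx : IsOdd x) (hy : IsOdd y) :
    IsEven (x * y) :=
  CliffordAlgebra.evenOdd_mul_le (0 : QuadraticForm F (I →₀ F)) 1 1 (Submodule.mul_mem_mul hx hy)

theorem IsEven.mul_isOdd {x y : Grassmann F I} (hx : IsEven x) (hy : IsOdd y) :
    IsOdd (x * y) := by
  have := CliffordAlgebra.evenOdd_mul_le (0 : QuadraticForm F (I →₀ F)) 0 1
    (Submodule.mul_mem_mul hx hy)
  rwa [zero_add] at this

/-- The product of three odd elements deformed by multiples of an odd element `e`. There are no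
terms of higher order because `e * e = 0`. -/
theorem mul_deformed {A B C a b c e : Grassmann F I} (hA : IsOdd A) (hB : IsOdd B)
    (hb : IsEven b) (hc : IsEven c) (he : IsOdd e) (hee : e * e = 0) :
    (A + a * e) * (B + b * e) * (C + c * e) =
      A * B * C + a * e * (B * C) - b * e * (A * C) + c * e * (A * B) := by
  have h0 : ∀ x y : Grassmann F I, IsEven y → x * e * (y * e) = 0 := fun x y hy => by
    rw [hy.commute, mul_assoc, ← mul_assoc e, hee, zero_mul, mul_zero]
  have hab := h0 a b hb
  have hac := h0 a c hc
  have hbc := h0 b c hc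
  have hAb : A * (b * e) = -(b * e * A) := hA.anticommute (hb.mul_isOdd he)
  have hBc : B * (c * e) = -(c * e * B) := hB.anticommute (hc.mul_isOdd he)
  have hABc : A * B * (c * e) = c * e * (A * B) := (hA.mul hB).commute _
  have h1 : A * (b * e) * (c * e) = 0 := by rw [mul_assoc, hbc, mul_zero]
  have h2 : a * e * B * (c * e) = 0 := by
    rw [mul_assoc, hBc, mul_neg, ← mul_assoc, hac, zero_mul, neg_zero]
  calc (A + a * e) * (B + b * e) * (C + c * e)
      = A * B * C + a * e * (B * C) + A * (b * e) * C + A * B * (c * e)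
        + (a * e) * (b * e) * (C + c * e) + A * (b * e) * (c * e) + a * e * B * (c * e) := by
        noncomm_ring
    _ = _ := by
      rw [hab, h1, h2, hAb, hABc]
      noncomm_ring

end Parity

/-! ### Inverse images of 1 under a contraction -/

section FaceWeights

variable {F : Type*} [Field F] {I : Type*}

/-- The elements that are polynomials in vectors annihilated by the functional `d`. -/
def dualKer (d : Module.Dual F (I →₀ F)) : Subalgebra F (Grassmann F I) :=
  Algebra.adjoin F (ExteriorAlgebra.ι F '' {v | d v = 0})

/-- The right contraction with a functional on the space of vectors. -/
def contractR : Module.Dual F (I →₀ F) →ₗ[F] Grassmann F I →ₗ[F] Grassmann F I :=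
  (CliffordAlgebra.contractRight (Q := (0 : QuadraticForm F (I →₀ F)))).flip

theorem contractR_mul_ι (d : Module.Dual F (I →₀ F)) (x : Grassmann F I) (v : I →₀ F) :
    contractR d (x * ExteriorAlgebra.ι F v) = d v • x - contractR d x * ExteriorAlgebra.ι F v :=
  CliffordAlgebra.contractRight_mul_ι (Q := (0 : QuadraticForm F (I →₀ F))) (d := d) v x

/-- A contraction vanishes on the polynomials in the kernel of its functional. -/
theorem contractR_eq_zero {d : Module.Dual F (I →₀ F)} {x : Grassmann F I} (hx : x ∈ dualKer d) :
    contractR d x = 0 := by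
  have key : ∀ x ∈ dualKer d, ∀ y : Grassmann F I, contractR d y = 0 → contractR d (y * x) = 0 := by
    intro x hx
    induction hx using Algebra.adjoin_induction with
    | mem x hx =>
      obtain ⟨v, hv, rfl⟩ := hx
      intro y hy
      rw [contractR_mul_ι, hy, hv.out, zero_smul, zero_mul, sub_zero]
    | algebraMap r =>
      intro y hy
      rw [← Algebra.commutes, ← Algebra.smul_def, map_smul, hy, smul_zero]
    | add a b _ _ ha hb => intro y hy; rw [mul_add, map_add, ha y hy, hb y hy, add_zero]
    | mul a b _ _ ha hb => intro y hy; rw [← mul_assoc]; exact hb _ (ha y hy)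
  have := key x hx 1 (CliffordAlgebra.contractRight_one (0 : QuadraticForm F (I →₀ F)) d)
  rwa [one_mul] at this

theorem berezin_self (i : I) (x : Grassmann F I) : berezin i (berezin i x) = 0 :=
  CliffordAlgebra.contractRight_contractRight (Q := (0 : QuadraticForm F (I →₀ F))) _ x

/-- A repeated integration over the same variable gives zero. -/
theorem berezinIter_berezin {l : List I} {i : I} (hi : i ∈ l) (x : Grassmann F I) :
    berezinIter l (berezin i x) = 0 := by
  induction l generalizing x with
  | nil => simp at hi
  | cons j l ih =>
    rw [berezinIter_cons]
    rcases eq_or_ne i j with rfl | hij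
    · rw [berezin_self, berezinIter_zero]
    · rw [berezin_comm, berezinIter_neg, ih ((List.mem_cons.1 hi).resolve_left hij), neg_zero]

theorem berezinIter_contractR (l : List I) (d : Module.Dual F (I →₀ F))
    (hd : d ∈ Submodule.span F {f | ∃ i ∈ l, f = Finsupp.lapply i}) (x : Grassmann F I) :
    berezinIter l (contractR d x) = 0 := by
  induction hd using Submodule.span_induction with
  | mem f hf =>
    obtain ⟨i, hi, rfl⟩ := hf
    exact berezinIter_berezin hi x
  | zero => rw [map_zero, LinearMap.zero_apply, berezinIter_zero]
  | add f g _ _ hf hg => rw [map_add, LinearMap.add_apply, berezinIter_add, hf, hg, add_zero]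
  | smul c f _ hf => rw [map_smul, LinearMap.smul_apply, berezinIter_smul, hf, smul_zero]

/-- Let `d` be a combination of the coordinates that are integrated over, and let `X` be a
polynomial in `ker d`. Then the integral of `X * v` depends on the vector `v` only through `d v`:
for `d y = 0` and `d z = 1`, the integrand `X * y` is the contraction of `X * y * z` with `d`, and
the integral of such a contraction vanishes. -/
theorem berezinIter_mul_ι_congr (l : List I) (d : Module.Dual F (I →₀ F))
    (hd : d ∈ Submodule.span F {f | ∃ i ∈ l, f = Finsupp.lapply i})
    {X : Grassmann F I} (hX : X ∈ dualKer d) {v w : I →₀ F} (hv : d v = 1) (hw : d w = 1) :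
    berezinIter l (X * ExteriorAlgebra.ι F v) = berezinIter l (X * ExteriorAlgebra.ι F w) := by
  have h0 : contractR d (X * ExteriorAlgebra.ι F (v - w)) = 0 := by
    rw [contractR_mul_ι, contractR_eq_zero hX, map_sub, hv, hw, sub_self, zero_smul, zero_mul,
      sub_zero]
  have h1 : contractR d (X * ExteriorAlgebra.ι F (v - w) * ExteriorAlgebra.ι F v) =
      X * ExteriorAlgebra.ι F (v - w) := by
    rw [contractR_mul_ι, h0, hv, one_smul, zero_mul, sub_zero]
  have h2 : X * ExteriorAlgebra.ι F v =
      X * ExteriorAlgebra.ι F w + X * ExteriorAlgebra.ι F (v - w) := by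
    rw [← mul_add, ← map_add, add_sub_cancel]
  rw [h2, berezinIter_add, ← h1, berezinIter_contractR l d hd, add_zero]

/-- The left contraction with a functional on the space of vectors. -/
def contractL : Module.Dual F (I →₀ F) →ₗ[F] Grassmann F I →ₗ[F] Grassmann F I :=
  CliffordAlgebra.contractLeft (Q := (0 : QuadraticForm F (I →₀ F)))

theorem contractL_algebraMap (d : Module.Dual F (I →₀ F)) (r : F) :
    contractL d (algebraMap F (Grassmann F I) r) = 0 :=
  CliffordAlgebra.contractLeft_algebraMap (0 : QuadraticForm F (I →₀ F)) d r

theorem contractL_ι_mul (d : Module.Dual F (I →₀ F)) (v : I →₀ F) (x : Grassmann F I) :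
    contractL d (ExteriorAlgebra.ι F v * x) = d v • x - ExteriorAlgebra.ι F v * contractL d x :=
  CliffordAlgebra.contractLeft_ι_mul (Q := (0 : QuadraticForm F (I →₀ F))) (d := d) v x

theorem contractL_ι (d : Module.Dual F (I →₀ F)) (v : I →₀ F) :
    contractL d (ExteriorAlgebra.ι F v) = algebraMap F (Grassmann F I) (d v) :=
  CliffordAlgebra.contractLeft_ι (0 : QuadraticForm F (I →₀ F)) d v

/-- A left contraction lowers degrees by one. -/
theorem contractL_of_mem_exteriorPower (d : Module.Dual F (I →₀ F)) (n : ℕ) (x : Grassmann F I)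
    (hx : x ∈ ⋀[F]^n (I →₀ F)) :
    contractL d x = 0 ∨ ∃ m, n = m + 1 ∧ contractL d x ∈ ⋀[F]^m (I →₀ F) := by
  induction hx using Submodule.pow_induction_on_left' with
  | algebraMap r => exact .inl (contractL_algebraMap d r)
  | add x y n _ _ hx hy =>
    rw [map_add]
    rcases hx with hx | ⟨m, hm, hx⟩
    · rwa [hx, zero_add]
    rcases hy with hy | ⟨m', hm', hy⟩
    · rw [hy, add_zero]
      exact .inr ⟨m, hm, hx⟩
    · obtain rfl : m = m' := by omega
      exact .inr ⟨m, hm, Submodule.add_mem _ hx hy⟩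
  | mem_mul v hv n x hx' hx =>
    obtain ⟨v, rfl⟩ := hv
    refine .inr ⟨n, rfl, ?_⟩
    rw [contractL_ι_mul]
    refine Submodule.sub_mem _ (Submodule.smul_mem _ _ hx') ?_
    rcases hx with hx | ⟨m, rfl, hx⟩
    · rw [hx, mul_zero]
      exact Submodule.zero_mem _
    · rw [ExteriorAlgebra.exteriorPower, pow_succ']
      exact Submodule.mul_mem_mul (LinearMap.mem_range_self _ v) hx

/-- A homogeneous element that a contraction maps to `1` has degree one. -/
theorem IsInverseOne.exists_ι {d : Module.Dual F (I →₀ F)} {w : Grassmann F I}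
    (hw : IsInverseOne (contractL d) w) :
    ∃ v : I →₀ F, d v = 1 ∧ w = ExteriorAlgebra.ι F v := by
  obtain ⟨⟨n, hn⟩, h1⟩ := hw
  have h10 : (1 : Grassmann F I) ≠ 0 := fun h =>
    one_ne_zero
      ((ExteriorAlgebra.algebraMap_eq_zero_iff (M := I →₀ F) (1 : F)).1 (by rwa [map_one]))
  rcases contractL_of_mem_exteriorPower d n w hn with h | ⟨m, rfl, h⟩
  · exact absurd (h1.symm.trans h) h10
  rw [h1] at h
  have h0 : (1 : Grassmann F I) ∈ ⋀[F]^0 (I →₀ F) := by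
    rw [ExteriorAlgebra.exteriorPower, pow_zero]
    exact Submodule.one_le.1 le_rfl
  obtain rfl := DirectSum.degree_eq_of_mem_mem (fun i : ℕ => ⋀[F]^i (I →₀ F)) h h0 h10
  rw [ExteriorAlgebra.exteriorPower, zero_add, pow_one] at hn
  obtain ⟨v, rfl⟩ := hn
  refine ⟨v, ?_, rfl⟩
  rw [contractL_ι] at h1
  exact (ExteriorAlgebra.algebraMap_eq_one_iff (M := I →₀ F) (d v)).1 h1

theorem isInverseOne_ι {d : Module.Dual F (I →₀ F)} {v : I →₀ F} (hv : d v = 1) :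
    IsInverseOne (contractL d) (ExteriorAlgebra.ι F v) := by
  refine ⟨⟨1, ?_⟩, by rw [contractL_ι, hv, map_one]⟩
  rw [ExteriorAlgebra.exteriorPower, pow_one]
  exact LinearMap.mem_range_self _ v

end FaceWeights

/-! ### Orientations and link relations -/

section Orientation

/-- The orientation of the six 4-simplices in which `12345` has the sign `s`. -/
def orientation (s : ℤˣ) (u : Finset ℕ) : ℤˣ :=
  if u = {1, 2, 3, 4, 6} ∨ u = {1, 3, 4, 5, 6} then -s else s

/-- A consistent orientation is determined by the sign of `12345`: compare the boundaries at two
inner and three outer tetrahedra. -/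
theorem IsConsistentOrientation.eq_orientation {ε : Finset ℕ → ℤˣ}
    (hε : IsConsistentOrientation ε lhs33 rhs33) :
    ∀ u ∈ lhs33 ∪ rhs33, ε u = orientation (ε {1, 2, 3, 4, 5}) u := by
  have h : ∀ t (SL SR : Finset ℕ), t.card = 4 →
      {v ∈ vertices lhs33 | v ∉ t ∧ insert v t ∈ lhs33} = SL →
      {v ∈ vertices rhs33 | v ∉ t ∧ insert v t ∈ rhs33} = SR →
      ∑ v ∈ SL, (ε (insert v t) : ℤ) * (-1) ^ (t.filter (fun x => x < v)).card =
      ∑ v ∈ SR, (ε (insert v t) : ℤ) * (-1) ^ (t.filter (fun x => x < v)).card := by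
    rintro t _ _ ht rfl rfl
    exact hε t ht
  have h1 := h {1, 2, 3, 4} {5, 6} ∅ (by decide) (by decide +kernel) (by decide +kernel)
  have h2 := h {1, 2, 3, 5} {4, 6} ∅ (by decide) (by decide +kernel) (by decide +kernel)
  have h3 := h {1, 2, 4, 5} {3} {6} (by decide) (by decide +kernel) (by decide +kernel)
  have h4 := h {1, 3, 4, 5} {2} {6} (by decide) (by decide +kernel) (by decide +kernel)
  have h5 := h {2, 3, 4, 5} {1} {6} (by decide) (by decide +kernel) (by decide +kernel)
  rw [Finset.sum_pair (by decide), Finset.sum_empty] at h1 h2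
  rw [Finset.sum_singleton, Finset.sum_singleton] at h3 h4 h5
  rw [show insert 5 {1, 2, 3, 4} = ({1, 2, 3, 4, 5} : Finset ℕ) by decide,
    show insert 6 {1, 2, 3, 4} = ({1, 2, 3, 4, 6} : Finset ℕ) by decide] at h1
  rw [show insert 4 {1, 2, 3, 5} = ({1, 2, 3, 4, 5} : Finset ℕ) by decide,
    show insert 6 {1, 2, 3, 5} = ({1, 2, 3, 5, 6} : Finset ℕ) by decide] at h2
  rw [show insert 3 {1, 2, 4, 5} = ({1, 2, 3, 4, 5} : Finset ℕ) by decide,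
    show insert 6 {1, 2, 4, 5} = ({1, 2, 4, 5, 6} : Finset ℕ) by decide] at h3
  rw [show insert 2 {1, 3, 4, 5} = ({1, 2, 3, 4, 5} : Finset ℕ) by decide,
    show insert 6 {1, 3, 4, 5} = ({1, 3, 4, 5, 6} : Finset ℕ) by decide] at h4
  rw [show insert 1 {2, 3, 4, 5} = ({1, 2, 3, 4, 5} : Finset ℕ) by decide,
    show insert 6 {2, 3, 4, 5} = ({2, 3, 4, 5, 6} : Finset ℕ) by decide] at h5
  simp [Finset.filter_insert, Finset.filter_singleton] at h1 h2 h3 h4 h5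
  intro u hu
  simp only [lhs33, rhs33, Finset.mem_union, Finset.mem_insert, Finset.mem_singleton] at hu
  rcases hu with (rfl | rfl | rfl) | (rfl | rfl | rfl) <;> simp +decide [orientation]
  all_goals exact Units.ext (by push_cast; linarith)

theorem orientedLink_congr {ε ε' : Finset ℕ → ℤˣ} {C : Finset (Finset ℕ)}
    (h : ∀ u ∈ C, ε u = ε' u) (k l m : ℕ) :
    orientedLink ε C k l m = orientedLink ε' C k l m := by
  refine Finset.filter_congr fun p _ => and_congr_right fun _ => and_congr_right fun hu => ?_
  rw [h _ hu]

/-- The link relation of the face `jkr`, which lies in two simplices `123qr`, `123pr` of the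
left-hand side and in the simplex `jk456` of the right-hand side. -/
theorem LinkRelations.eq {F : Type*} [Field F] {κ : Type*} {ζ : ℕ → F} {ε : Finset ℕ → ℤˣ}
    (hε : IsConsistentOrientation ε lhs33 rhs33) {α : Finset ℕ → Grassmann F (Gen κ)}
    (hlink : LinkRelations ζ ε lhs33 rhs33 α) (i j k p q r : ℕ)
    (hi : (i, j, k) ∈ ({(1, 2, 3), (2, 1, 3), (3, 1, 2)} : Set (ℕ × ℕ × ℕ)))
    (hp : (p, q, r) ∈ ({(4, 5, 6), (4, 6, 5), (5, 6, 4)} : Set (ℕ × ℕ × ℕ))) :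
    (ζ i - ζ q) • α {1, 2, 3, q, r} - (ζ i - ζ p) • α {1, 2, 3, p, r} =
      (ζ p - ζ q) • α {j, k, 4, 5, 6} := by
  have hL : (∃ s : ℤˣ, s = ε {1, 2, 3, 4, 5} ∧
      ((orientedLink (orientation s) lhs33 j k r = {(i, q), (p, i)} ∧
        orientedLink (orientation s) rhs33 j k r = {(p, q)}) ∨
      (orientedLink (orientation s) lhs33 j k r = {(q, i), (i, p)} ∧
        orientedLink (orientation s) rhs33 j k r = {(q, p)}))) := by
    refine ⟨_, rfl, ?_⟩
    -- For both signs `s` the links are finite sets that can be computed.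
    generalize ε {1, 2, 3, 4, 5} = s
    rcases hi with h | h | h <;> cases h <;> rcases hp with h | h | h <;> cases h <;>
    revert s <;> decide +kernel
  obtain ⟨s, hs, hL⟩ := hL
  have hrel := hlink j k r
    (by rcases hi with h | h | h <;> cases h <;> simp)
    (by rcases hi with h | h | h <;> cases h <;> rcases hp with h | h | h <;> cases h <;> simp)
    (by
      rcases hi with h | h | h <;> cases h <;> rcases hp with h | h | h <;> cases h <;>
      decide +kernel)
  have hor := hε.eq_orientation
  rw [← hs] at hor
  rw [orientedLink_congr fun u hu => hor u (Finset.mem_union_left _ hu),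
    orientedLink_congr fun u hu => hor u (Finset.mem_union_right _ hu)] at hrel
  have hne : i ≠ p ∧ i ≠ q := by
    rcases hi with h | h | h <;> cases h <;> rcases hp with h | h | h <;> cases h <;> simp
  have e1 : ({i, q, j, k, r} : Finset ℕ) = {1, 2, 3, q, r} ∧
      ({q, i, j, k, r} : Finset ℕ) = {1, 2, 3, q, r} ∧
      ({i, p, j, k, r} : Finset ℕ) = {1, 2, 3, p, r} ∧
      ({p, i, j, k, r} : Finset ℕ) = {1, 2, 3, p, r} ∧
      ({p, q, j, k, r} : Finset ℕ) = {j, k, 4, 5, 6} ∧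
      ({q, p, j, k, r} : Finset ℕ) = {j, k, 4, 5, 6} := by
    rcases hi with h | h | h <;> cases h <;> rcases hp with h | h | h <;> cases h <;>
    decide +kernel
  obtain ⟨e1, e2, e3, e4, e5, e6⟩ := e1
  rcases hL with ⟨h1, h2⟩ | ⟨h1, h2⟩
  · rw [h1, h2, Finset.sum_pair (by simp [hne.1]), Finset.sum_singleton] at hrel
    simp only [e1, e4, e5] at hrel
    rw [← hrel]
    module
  · rw [h1, h2, Finset.sum_pair (by simp [hne.2.symm]), Finset.sum_singleton] at hrel
    simp only [e2, e3, e6] at hrel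
    rw [← neg_sub (ζ q) (ζ p), neg_smul, ← hrel]
    module

end Orientation

/-! ### Weights and face operators of the two clusters -/

section Vectors

variable {F : Type*} [Field F] {κ : Type*}

/-- The vector whose image in the Grassmann algebra is the generator `a_{ijkl}`. -/
def vecA (i j k l : ℕ) : Gen κ →₀ F := Finsupp.single (Gen.a {i, j, k, l}) 1

/-- The vector whose image in the Grassmann algebra is the generator `b_{ijkl}`. -/
def vecB (i j k l : ℕ) : Gen κ →₀ F := Finsupp.single (Gen.b {i, j, k, l}) 1

theorem vecA_apply_a (i j k l : ℕ) (t : Finset ℕ) :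
    (vecA i j k l : Gen κ →₀ F) (Gen.a t) = if ({i, j, k, l} : Finset ℕ) = t then 1 else 0 := by
  classical
  rw [vecA, Finsupp.single_apply]
  simp only [Gen.a.injEq]

theorem vecA_apply_b (i j k l : ℕ) (t : Finset ℕ) :
    (vecA i j k l : Gen κ →₀ F) (Gen.b t) = 0 := by
  classical
  rw [vecA, Finsupp.single_apply, if_neg (by simp)]

theorem vecB_apply_a (i j k l : ℕ) (t : Finset ℕ) :
    (vecB i j k l : Gen κ →₀ F) (Gen.a t) = 0 := by
  classical
  rw [vecB, Finsupp.single_apply, if_neg (by simp)]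

theorem vecB_apply_b (i j k l : ℕ) (t : Finset ℕ) :
    (vecB i j k l : Gen κ →₀ F) (Gen.b t) = if ({i, j, k, l} : Finset ℕ) = t then 1 else 0 := by
  classical
  rw [vecB, Finsupp.single_apply]
  simp only [Gen.b.injEq]

/-- The three linear factors of a weight, with the variables of the tetrahedra `ijkl`, `ijkm`
separated from the others. -/
theorem weight_eq (ζ : ℕ → F) (i j k l m : ℕ) :
    (weight ζ i j k l m : Grassmann F (Gen κ)) = (ζ l - ζ m)⁻¹ • prodι
      [(ζ k - ζ l) • vecA i j k l - (ζ k - ζ m) • vecA i j k m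
        + (ζ l - ζ m) • (vecA i j l m - vecA i k l m),
       (ζ k - ζ l) • vecB i j k l - (ζ k - ζ m) • vecB i j k m
        + (ζ l - ζ m) • (vecB i j l m + vecA j k l m),
       -(ζ i - ζ l) • vecA i j k l - (ζ j - ζ l) • vecB i j k l
        + (ζ i - ζ m) • vecA i j k m + (ζ j - ζ m) • vecB i j k m
        + (ζ l - ζ m) • (vecB j k l m - vecB i k l m)] := by
  have hA : ∀ i j k l, (ga i j k l : Grassmann F (Gen κ)) = ExteriorAlgebra.ι F (vecA i j k l) :=
    fun _ _ _ _ => rfl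
  have hB : ∀ i j k l, (gb i j k l : Grassmann F (Gen κ)) = ExteriorAlgebra.ι F (vecB i j k l) :=
    fun _ _ _ _ => rfl
  rw [weight]
  simp only [hA, hB, prodι_cons, prodι_nil, mul_one, ← map_smul, ← map_add, ← map_sub, mul_assoc]
  refine congrArg _ (congrArg₂ _ (congrArg _ ?_) (congrArg₂ _ (congrArg _ ?_) (congrArg _ ?_))) <;>
  module

/-- The formula for the weight is symmetric in the last two vertices, since all three factors and
the scalar in front change their signs. -/
theorem weight_swap (ζ : ℕ → F) (i j k l m : ℕ) :
    (weight ζ i j k m l : Grassmann F (Gen κ)) = weight ζ i j k l m := by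
  have h : ∀ i j : ℕ, ({i, j, m, l} : Finset ℕ) = {i, j, l, m} := fun i j => by
    rw [Finset.pair_comm]
  have hA : ∀ i j, (vecA i j m l : Gen κ →₀ F) = vecA i j l m := fun i j => by
    rw [vecA, vecA, h]
  have hB : ∀ i j, (vecB i j m l : Gen κ →₀ F) = vecB i j l m := fun i j => by
    rw [vecB, vecB, h]
  rw [weight_eq, weight_eq, ← neg_sub (ζ l) (ζ m), hA, hA, hA, hB, hB, hB]
  have e : ∀ x y z x' y' z' : Gen κ →₀ F, x' = -x → y' = -y → z' = -z →
      (-(ζ l - ζ m))⁻¹ • (prodι [x', y', z'] : Grassmann F (Gen κ)) =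
        (ζ l - ζ m)⁻¹ • prodι [x, y, z] := by
    rintro x y z _ _ _ rfl rfl rfl
    rw [inv_neg]
    simp [-neg_sub]
  apply e <;> module

theorem isOdd_weight (ζ : ℕ → F) (i j k l m : ℕ) :
    IsOdd (weight ζ i j k l m : Grassmann F (Gen κ)) := by
  rw [weight_eq]
  exact (isOdd_ι_mul_ι_mul_ι _ _ _).smul _

end Vectors

section Duals

variable {F : Type*} [Field F] {κ : Type*}

/-- The functional on vectors whose contraction is the operator `d₁₂₃` on the left-hand side. -/
def lhsDual (ζ : ℕ → F) : Module.Dual F (Gen κ →₀ F) :=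
  ∑ p ∈ {4, 5, 6}, (((ζ 2 - ζ 3) / (ζ 3 - ζ p)) • Finsupp.lapply (Gen.a {1, 2, 3, p})
    - ((ζ 1 - ζ 3) / (ζ 3 - ζ p)) • Finsupp.lapply (Gen.b {1, 2, 3, p}))

/-- The functional on vectors whose contraction is the operator `d₄₅₆` on the right-hand side. -/
def rhsDual : Module.Dual F (Gen κ →₀ F) :=
  ∑ i ∈ {1, 2, 3}, -Finsupp.lapply (Gen.b {i, 4, 5, 6})

theorem faceOp_lhs (ζ : ℕ → F) :
    (faceOp ζ lhs33 {1, 2, 3} : Grassmann F (Gen κ) →ₗ[F] _) = contractL (lhsDual ζ) := by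
  have h : (tetrahedra lhs33).filter
      (fun q => ({1, 2, 3} : Finset ℕ) ⊆ {q.1, q.2.1, q.2.2.1, q.2.2.2}) =
      {(1, 2, 3, 4), (1, 2, 3, 5), (1, 2, 3, 6)} := by
    decide +kernel
  have hd : ∀ i, (leftDeriv i : Grassmann F (Gen κ) →ₗ[F] _) = contractL (Finsupp.lapply i) :=
    fun _ => rfl
  rw [faceOp, h, lhsDual]
  simp [tetFaceOp, hd]
  abel

theorem faceOp_rhs (ζ : ℕ → F) :
    (faceOp ζ rhs33 {4, 5, 6} : Grassmann F (Gen κ) →ₗ[F] _) = contractL rhsDual := by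
  have h : (tetrahedra rhs33).filter
      (fun q => ({4, 5, 6} : Finset ℕ) ⊆ {q.1, q.2.1, q.2.2.1, q.2.2.2}) =
      {(1, 4, 5, 6), (2, 4, 5, 6), (3, 4, 5, 6)} := by
    decide +kernel
  have hd : ∀ i, (leftDeriv i : Grassmann F (Gen κ) →ₗ[F] _) = contractL (Finsupp.lapply i) :=
    fun _ => rfl
  have ht : ∀ i ∈ ({1, 2, 3} : Finset ℕ),
      (tetFaceOp ζ i 4 5 6 {4, 5, 6} : Grassmann F (Gen κ) →ₗ[F] _) =
        contractL (-Finsupp.lapply (Gen.b {i, 4, 5, 6})) := by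
    intro i hi
    rw [tetFaceOp, if_neg, if_neg, if_neg, if_pos rfl, map_neg, hd] <;>
      revert i <;> decide +kernel
  rw [faceOp, h, rhsDual, map_sum, Finset.sum_congr rfl fun i hi => (ht i hi).symm]
  simp

theorem lhsDual_mem (ζ : ℕ → F) :
    (lhsDual ζ : Module.Dual F (Gen κ →₀ F)) ∈
      Submodule.span F {f | ∃ i ∈ lhsVars κ, f = Finsupp.lapply i} := by
  refine Submodule.sum_mem _ fun p hp => ?_
  have h : Gen.a {1, 2, 3, p} ∈ lhsVars κ ∧ Gen.b {1, 2, 3, p} ∈ lhsVars κ := by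
    fin_cases hp <;> simp [lhsVars]
  exact Submodule.sub_mem _
    (Submodule.smul_mem _ _ (Submodule.subset_span ⟨_, h.1, rfl⟩))
    (Submodule.smul_mem _ _ (Submodule.subset_span ⟨_, h.2, rfl⟩))

theorem rhsDual_mem :
    (rhsDual : Module.Dual F (Gen κ →₀ F)) ∈
      Submodule.span F {f | ∃ i ∈ rhsVars κ, f = Finsupp.lapply i} := by
  refine Submodule.sum_mem _ fun p hp => ?_
  have h : Gen.b {p, 4, 5, 6} ∈ rhsVars κ := by
    fin_cases hp <;> simp [rhsVars]
  exact Submodule.neg_mem _ (Submodule.subset_span ⟨_, h, rfl⟩)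

theorem weight_mem_dualKer {d : Module.Dual F (Gen κ →₀ F)} {ζ : ℕ → F} {i j k l m : ℕ}
    (h₁ : d ((ζ k - ζ l) • vecA i j k l - (ζ k - ζ m) • vecA i j k m
        + (ζ l - ζ m) • (vecA i j l m - vecA i k l m)) = 0)
    (h₂ : d ((ζ k - ζ l) • vecB i j k l - (ζ k - ζ m) • vecB i j k m
        + (ζ l - ζ m) • (vecB i j l m + vecA j k l m)) = 0)
    (h₃ : d (-(ζ i - ζ l) • vecA i j k l - (ζ j - ζ l) • vecB i j k l
        + (ζ i - ζ m) • vecA i j k m + (ζ j - ζ m) • vecB i j k m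
        + (ζ l - ζ m) • (vecB j k l m - vecB i k l m)) = 0) :
    weight ζ i j k l m ∈ dualKer d := by
  have h : ∀ v, d v = 0 → ExteriorAlgebra.ι F v ∈ dualKer d := fun v hv =>
    Algebra.subset_adjoin ⟨v, hv, rfl⟩
  rw [weight_eq]
  simp only [prodι_cons, prodι_nil, mul_one]
  exact Subalgebra.smul_mem _ (mul_mem (h _ h₁) (mul_mem (h _ h₂) (h _ h₃))) _

theorem weight_mem_dualKer_lhs {ζ : ℕ → F} (h : ∀ p ∈ ({4, 5, 6} : Set ℕ), ζ 3 - ζ p ≠ 0)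
    (p q : ℕ)
    (hpq : (p, q) ∈ ({(4, 5), (4, 6), (5, 6), (5, 4), (6, 4), (6, 5)} : Set (ℕ × ℕ))) :
    (weight ζ 1 2 3 p q : Grassmann F (Gen κ)) ∈ dualKer (lhsDual ζ) := by
  have h4 := h 4 (by simp)
  have h5 := h 5 (by simp)
  have h6 := h 6 (by simp)
  rcases hpq with hpq | hpq | hpq | hpq | hpq | hpq <;> obtain ⟨rfl, rfl⟩ := Prod.mk.inj hpq <;>
  apply weight_mem_dualKer <;>
  simp +decide [lhsDual, vecA_apply_a, vecA_apply_b, vecB_apply_a, vecB_apply_b] <;>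
  field_simp <;> ring

theorem weight_mem_dualKer_rhs (ζ : ℕ → F)
    (i j : ℕ) (hij : (i, j) ∈ ({(1, 2), (1, 3), (2, 3)} : Set (ℕ × ℕ))) :
    (weight ζ i j 4 5 6 : Grassmann F (Gen κ)) ∈ dualKer rhsDual := by
  rcases hij with hij | hij | hij <;> obtain ⟨rfl, rfl⟩ := Prod.mk.inj hij <;>
  apply weight_mem_dualKer <;>
  simp +decide [rhsDual, vecA_apply_b, vecB_apply_b]

end Duals

/-! ### Integrals of two weights and a face weight -/

section Pairs

variable {F : Type*} [Field F] {κ : Type*}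

/-- The vector `u_pq = a_12pq - a_13pq`. It involves outer variables only, and it is symmetric in
`p` and `q`. -/
def vecU (p q : ℕ) : Gen κ →₀ F := vecA 1 2 p q - vecA 1 3 p q

/-- The vector `v_pq = b_12pq + a_23pq`. -/
def vecV (p q : ℕ) : Gen κ →₀ F := vecB 1 2 p q + vecA 2 3 p q

/-- The vector `w_pq = b_23pq - b_13pq`. -/
def vecW (p q : ℕ) : Gen κ →₀ F := vecB 2 3 p q - vecB 1 3 p q

/-- The vector `T_pq = ζ_1q u_pq + ζ_2q v_pq + ζ_3q w_pq`, which is not symmetric in `p` and `q`.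
It is the outer part of the combination of the factors of the weight of `123pq` in which the
variables of the tetrahedron `123q` cancel. -/
def vecT (ζ : ℕ → F) (p q : ℕ) : Gen κ →₀ F :=
  (ζ 1 - ζ q) • vecU p q + (ζ 2 - ζ q) • vecV p q + (ζ 3 - ζ q) • vecW p q

/-- The integral of the weights of two simplices of the left-hand side with the common inner
tetrahedron `123p`; the variables of this tetrahedron are integrated first. -/
theorem berezinIter_weight_mul_weight_lhs {ζ : ℕ → F} (hζ : Set.InjOn ζ (Set.Icc 1 6)) (p q r : ℕ)
    (h : (p, q, r) ∈ ({(4, 5, 6), (5, 4, 6), (6, 4, 5)} : Set (ℕ × ℕ × ℕ))) :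
    berezinIter [Gen.a {1, 2, 3, p}, Gen.b {1, 2, 3, p}, Gen.a {1, 2, 3, q}, Gen.b {1, 2, 3, q},
        Gen.a {1, 2, 3, r}, Gen.b {1, 2, 3, r}]
      (weight ζ 1 2 3 p q * weight ζ 1 2 3 p r * ExteriorAlgebra.ι F (vecA 1 2 3 p)) =
    ((ζ 2 - ζ 3) * (ζ 3 - ζ q) * (ζ 3 - ζ r)) •
      (ExteriorAlgebra.ι F (vecT ζ p r - vecT ζ p q) : Grassmann F (Gen κ)) := by
  have hne : ∀ i j, i ∈ Set.Icc 1 6 → j ∈ Set.Icc 1 6 → i ≠ j → ζ i - ζ j ≠ 0 :=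
    fun i j hi hj hij h => hij (hζ hi hj (sub_eq_zero.1 h))
  have h23 : ζ 2 - ζ 3 ≠ 0 := by apply hne <;> simp
  have hpq : ζ p - ζ q ≠ 0 := by
    apply hne <;> rcases h with h | h | h <;> cases h <;> simp
  have hpr : ζ p - ζ r ≠ 0 := by
    apply hne <;> rcases h with h | h | h <;> cases h <;> simp
  have h3q : ζ 3 - ζ q ≠ 0 := by
    apply hne <;> rcases h with h | h | h <;> cases h <;> simp
  have h3r : ζ 3 - ζ r ≠ 0 := by
    apply hne <;> rcases h with h | h | h <;> cases h <;> simp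
  have key := berezinIter_lhsPair
    ![Gen.a {1, 2, 3, p}, Gen.b {1, 2, 3, p}, Gen.a {1, 2, 3, q}, Gen.b {1, 2, 3, q},
        Gen.a {1, 2, 3, r}, Gen.b {1, 2, 3, r}]
    ![vecA 1 2 3 p, vecB 1 2 3 p, vecA 1 2 3 q, vecB 1 2 3 q, vecA 1 2 3 r, vecB 1 2 3 r]
    (by
      intro n m
      rcases h with h | h | h <;> cases h <;> fin_cases n <;> fin_cases m <;>
      simp +decide [vecA_apply_a, vecA_apply_b, vecB_apply_a, vecB_apply_b])
    (ζ 1) (ζ 2) (ζ 3) (ζ p) (ζ q) (ζ r) h23 hpq h3q h3r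
    (vecU p q : Gen κ →₀ F) (vecV p q) (vecW p q) (vecU p r) (vecV p r) (vecW p r)
  have hout : ∀ s ∈ ({q, r} : Set ℕ), ∀ v ∈ ({vecU p s, vecV p s, vecW p s} : Set (Gen κ →₀ F)),
      ∀ n, v (![Gen.a {1, 2, 3, p}, Gen.b {1, 2, 3, p}, Gen.a {1, 2, 3, q}, Gen.b {1, 2, 3, q},
        Gen.a {1, 2, 3, r}, Gen.b {1, 2, 3, r}] n) = 0 := by
    intro s hs v hv n
    rcases hv with rfl | rfl | rfl <;> rcases hs with rfl | rfl <;>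
    rcases h with h | h | h <;> cases h <;> fin_cases n <;>
    simp +decide [vecU, vecV, vecW, vecA_apply_a, vecA_apply_b, vecB_apply_a, vecB_apply_b]
  specialize key (hout q (by simp) _ (by simp)) (hout q (by simp) _ (by simp))
    (hout q (by simp) _ (by simp)) (hout r (by simp) _ (by simp)) (hout r (by simp) _ (by simp))
    (hout r (by simp) _ (by simp))
  rw [weight_eq, weight_eq, smul_prodι_mul_smul_prodι_mul_ι, berezinIter_smul]
  refine (congrArg _ key).trans ?_
  have hc : (ζ p - ζ q)⁻¹ * (ζ p - ζ r)⁻¹ *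
      ((ζ 2 - ζ 3) * (ζ 3 - ζ q) * (ζ 3 - ζ r) * (ζ p - ζ q) * (ζ p - ζ r)) =
      (ζ 2 - ζ 3) * (ζ 3 - ζ q) * (ζ 3 - ζ r) := by
    field_simp
  rw [smul_smul, hc, vecT, vecT]

theorem berezinIter_lhs {ζ : ℕ → F} (hζ : Set.InjOn ζ (Set.Icc 1 6)) {v : Gen κ →₀ F}
    (hv : lhsDual ζ v = 1) (p q r : ℕ)
    (h : (p, q, r) ∈ ({(4, 5, 6), (5, 4, 6), (6, 4, 5)} : Set (ℕ × ℕ × ℕ))) :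
    ((ζ 3 - ζ 4)⁻¹ * (ζ 3 - ζ 5)⁻¹ * (ζ 3 - ζ 6)⁻¹) • berezinIter (lhsVars κ)
      (weight ζ 1 2 3 p q * weight ζ 1 2 3 p r * ExteriorAlgebra.ι F v) =
    ExteriorAlgebra.ι F (vecT ζ p r - vecT ζ p q) := by
  have hne : ∀ i j, i ∈ Set.Icc 1 6 → j ∈ Set.Icc 1 6 → i ≠ j → ζ i - ζ j ≠ 0 :=
    fun i j hi hj hij h => hij (hζ hi hj (sub_eq_zero.1 h))
  have h23 : ζ 2 - ζ 3 ≠ 0 := by apply hne <;> simp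
  have h3 : ∀ p ∈ ({4, 5, 6} : Set ℕ), ζ 3 - ζ p ≠ 0 := by
    intro p hp
    apply hne <;> rcases hp with rfl | rfl | rfl <;> simp
  have h34 := h3 4 (by simp)
  have h35 := h3 5 (by simp)
  have h36 := h3 6 (by simp)
  have h3p : ζ 3 - ζ p ≠ 0 := by
    apply h3; rcases h with h | h | h <;> cases h <;> simp
  have hX : (weight ζ 1 2 3 p q * weight ζ 1 2 3 p r : Grassmann F (Gen κ)) ∈
      dualKer (lhsDual ζ) := by
    refine mul_mem (weight_mem_dualKer_lhs h3 _ _ ?_) (weight_mem_dualKer_lhs h3 _ _ ?_) <;>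
    rcases h with h | h | h <;> cases h <;> simp
  -- The face weight is chosen so that it involves the common tetrahedron.
  have hw : lhsDual ζ (((ζ 3 - ζ p) / (ζ 2 - ζ 3)) • vecA 1 2 3 p : Gen κ →₀ F) = 1 := by
    rcases h with h | h | h <;> cases h <;>
    simp +decide [lhsDual, vecA_apply_a, vecA_apply_b] <;> field_simp
  -- Double integrals over the variables of one tetrahedron commute with one another.
  have hl : ∀ x : Grassmann F (Gen κ), berezinIter (lhsVars κ) x =
      berezinIter [Gen.a {1, 2, 3, p}, Gen.b {1, 2, 3, p}, Gen.a {1, 2, 3, q}, Gen.b {1, 2, 3, q},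
        Gen.a {1, 2, 3, r}, Gen.b {1, 2, 3, r}] x := by
    intro x
    rcases h with h | h | h <;> cases h
    · rfl
    · exact berezinIter_swap _ _ _ _ _ x
    · rw [berezinIter_swap (Gen.a {1, 2, 3, 6}), berezinIter_cons, berezinIter_cons,
        berezinIter_swap, ← berezinIter_cons, ← berezinIter_cons, lhsVars]
  have hc : (ζ 3 - ζ 4)⁻¹ * (ζ 3 - ζ 5)⁻¹ * (ζ 3 - ζ 6)⁻¹ * ((ζ 3 - ζ p) / (ζ 2 - ζ 3)) *
      ((ζ 2 - ζ 3) * (ζ 3 - ζ q) * (ζ 3 - ζ r)) = 1 := by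
    rcases h with h | h | h <;> cases h <;> field_simp
  rw [berezinIter_mul_ι_congr _ _ (lhsDual_mem ζ) hX hv hw, hl, map_smul, mul_smul_comm,
    berezinIter_smul, berezinIter_weight_mul_weight_lhs hζ p q r h, smul_smul, smul_smul, hc,
    one_smul]

/-- The three linear factors of a weight, with the variables of the tetrahedra `iklm`, `jklm`
separated from the others. -/
theorem weight_eq' (ζ : ℕ → F) (i j k l m : ℕ) :
    (weight ζ i j k l m : Grassmann F (Gen κ)) = (ζ l - ζ m)⁻¹ • prodι
      [((ζ k - ζ l) • vecA i j k l - (ζ k - ζ m) • vecA i j k m + (ζ l - ζ m) • vecA i j l m)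
        - (ζ l - ζ m) • vecA i k l m,
       ((ζ k - ζ l) • vecB i j k l - (ζ k - ζ m) • vecB i j k m + (ζ l - ζ m) • vecB i j l m)
        + (ζ l - ζ m) • vecA j k l m,
       (-(ζ i - ζ l) • vecA i j k l - (ζ j - ζ l) • vecB i j k l
        + (ζ i - ζ m) • vecA i j k m + (ζ j - ζ m) • vecB i j k m)
        - (ζ l - ζ m) • vecB i k l m + (ζ l - ζ m) • vecB j k l m] := by
  rw [weight_eq]
  have e : ∀ x y z x' y' z' : Gen κ →₀ F, x = x' → y = y' → z = z' →
      (prodι [x, y, z] : Grassmann F (Gen κ)) = prodι [x', y', z'] := by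
    rintro x y z _ _ _ rfl rfl rfl
    rfl
  refine congrArg _ ?_
  apply e <;> module

/-- The alternating sum `ζ₄₅ x₄₅ - ζ₄₆ x₄₆ + ζ₅₆ x₅₆` over the edges of the triangle `456`. -/
def sum456 (ζ : ℕ → F) (x : ℕ → ℕ → Gen κ →₀ F) : Gen κ →₀ F :=
  (ζ 4 - ζ 5) • x 4 5 - (ζ 4 - ζ 6) • x 4 6 + (ζ 5 - ζ 6) • x 5 6

/-- In the coefficients, `i` is the vertex of the common tetrahedron `i456` of the two simplices. -/
theorem berezinIter_rhsVars_prodι (i j k : ℕ)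
    (h : (i, j, k) ∈ ({(1, 2, 3), (2, 1, 3), (3, 1, 2)} : Set (ℕ × ℕ × ℕ))) (c : F)
    {u v w u' v' w' : Gen κ →₀ F}
    (ho : ∀ x ∈ ({u, v, w, u', v', w'} : Set (Gen κ →₀ F)), ∀ n ∈ rhsVars κ, x n = 0) :
    berezinIter (rhsVars κ) (prodι
      [u - c • vecA i 4 5 6, v + c • vecA j 4 5 6, w - c • vecB i 4 5 6 + c • vecB j 4 5 6,
       u' - c • vecA i 4 5 6, v' + c • vecA k 4 5 6, w' - c • vecB i 4 5 6 + c • vecB k 4 5 6,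
       -vecB i 4 5 6]) = c ^ 5 • ExteriorAlgebra.ι F (u' - u) := by
  have hl : ∀ x : Grassmann F (Gen κ), berezinIter (rhsVars κ) x =
      berezinIter [Gen.a {i, 4, 5, 6}, Gen.b {i, 4, 5, 6}, Gen.a {j, 4, 5, 6}, Gen.b {j, 4, 5, 6},
        Gen.a {k, 4, 5, 6}, Gen.b {k, 4, 5, 6}] x := by
    intro x
    rcases h with h | h | h <;> cases h
    · rfl
    · exact berezinIter_swap _ _ _ _ _ x
    · rw [berezinIter_swap (Gen.a {3, 4, 5, 6}), berezinIter_cons, berezinIter_cons,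
        berezinIter_swap, ← berezinIter_cons, ← berezinIter_cons, rhsVars]
  have hv : ∀ n, ![Gen.a {i, 4, 5, 6}, Gen.b {i, 4, 5, 6}, Gen.a {j, 4, 5, 6}, Gen.b {j, 4, 5, 6},
      Gen.a {k, 4, 5, 6}, Gen.b {k, 4, 5, 6}] n ∈ rhsVars κ := by
    intro n
    rcases h with h | h | h <;> cases h <;> fin_cases n <;> simp [rhsVars]
  rw [hl]
  exact berezinIter_rhsPair
    ![Gen.a {i, 4, 5, 6}, Gen.b {i, 4, 5, 6}, Gen.a {j, 4, 5, 6}, Gen.b {j, 4, 5, 6},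
      Gen.a {k, 4, 5, 6}, Gen.b {k, 4, 5, 6}]
    ![vecA i 4 5 6, vecB i 4 5 6, vecA j 4 5 6, vecB j 4 5 6, vecA k 4 5 6, vecB k 4 5 6]
    (by
      intro n m
      rcases h with h | h | h <;> cases h <;> fin_cases n <;> fin_cases m <;>
      simp +decide [vecA_apply_a, vecA_apply_b, vecB_apply_a, vecB_apply_b])
    c u v w u' v' w' (fun n => ho _ (by simp) _ (hv n)) (fun n => ho _ (by simp) _ (hv n))
    (fun n => ho _ (by simp) _ (hv n)) (fun n => ho _ (by simp) _ (hv n))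
    (fun n => ho _ (by simp) _ (hv n)) (fun n => ho _ (by simp) _ (hv n))

/-- The part of the third factor of the weight of `ij456` that is free of inner variables. -/
def vecR (ζ : ℕ → F) (i j : ℕ) : Gen κ →₀ F :=
  -(ζ i - ζ 5) • vecA i j 4 5 - (ζ j - ζ 5) • vecB i j 4 5
    + (ζ i - ζ 6) • vecA i j 4 6 + (ζ j - ζ 6) • vecB i j 4 6

theorem sum456_vecR_apply (ζ : ℕ → F) (i j : ℕ)
    (hij : (i, j) ∈ ({(1, 2), (1, 3), (2, 3)} : Set (ℕ × ℕ))) :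
    ∀ n ∈ rhsVars κ, sum456 ζ (vecA i j) n = 0 ∧ sum456 ζ (vecB i j) n = 0 ∧ vecR ζ i j n = 0 := by
  intro n hn
  rcases hij with h | h | h <;> obtain ⟨rfl, rfl⟩ := Prod.mk.inj h <;>
  fin_cases hn <;>
  simp +decide [sum456, vecR, vecA_apply_a, vecA_apply_b, vecB_apply_a, vecB_apply_b]

theorem weight_eq_rhs (ζ : ℕ → F) (i j : ℕ) :
    (weight ζ i j 4 5 6 : Grassmann F (Gen κ)) = (ζ 5 - ζ 6)⁻¹ • prodι
      [sum456 ζ (vecA i j) - (ζ 5 - ζ 6) • vecA i 4 5 6,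
       sum456 ζ (vecB i j) + (ζ 5 - ζ 6) • vecA j 4 5 6,
       vecR ζ i j - (ζ 5 - ζ 6) • vecB i 4 5 6 + (ζ 5 - ζ 6) • vecB j 4 5 6] :=
  weight_eq' ζ i j 4 5 6

/-- The factors of the weight of `ij456` in the form where the variables of the tetrahedra `i456`
and `j456` have exchanged their roles. -/
theorem weight_eq_rhs' (ζ : ℕ → F) (i j : ℕ) :
    (weight ζ i j 4 5 6 : Grassmann F (Gen κ)) = (ζ 5 - ζ 6)⁻¹ • prodι
      [-sum456 ζ (vecB i j) - (ζ 5 - ζ 6) • vecA j 4 5 6,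
       -sum456 ζ (vecA i j) + (ζ 5 - ζ 6) • vecA i 4 5 6,
       -vecR ζ i j - (ζ 5 - ζ 6) • vecB j 4 5 6 + (ζ 5 - ζ 6) • vecB i 4 5 6] := by
  rw [weight_eq_rhs]
  have e : ∀ x y z x' y' z' : Gen κ →₀ F, x' = -y → y' = -x → z' = -z →
      (prodι [x, y, z] : Grassmann F (Gen κ)) = prodι [x', y', z'] := by
    rintro x y z _ _ _ rfl rfl rfl
    simp only [prodι_cons, prodι_nil, mul_one, map_neg, ← mul_assoc, neg_mul, mul_neg, neg_neg,
      ι_mul_ι_swap y x]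
  refine congrArg _ ?_
  apply e <;> module

theorem berezinIter_rhs {ζ : ℕ → F} (hζ : Set.InjOn ζ (Set.Icc 1 6)) {v : Gen κ →₀ F}
    (hv : rhsDual v = 1) :
    ((ζ 5 - ζ 6)⁻¹ * (ζ 5 - ζ 6)⁻¹ * (ζ 5 - ζ 6)⁻¹) • berezinIter (rhsVars κ)
      (weight ζ 1 2 4 5 6 * weight ζ 1 3 4 5 6 * ExteriorAlgebra.ι F v) =
        -ExteriorAlgebra.ι F (sum456 ζ vecU) ∧
    ((ζ 5 - ζ 6)⁻¹ * (ζ 5 - ζ 6)⁻¹ * (ζ 5 - ζ 6)⁻¹) • berezinIter (rhsVars κ)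
      (weight ζ 1 2 4 5 6 * weight ζ 2 3 4 5 6 * ExteriorAlgebra.ι F v) =
        ExteriorAlgebra.ι F (sum456 ζ vecV) ∧
    ((ζ 5 - ζ 6)⁻¹ * (ζ 5 - ζ 6)⁻¹ * (ζ 5 - ζ 6)⁻¹) • berezinIter (rhsVars κ)
      (weight ζ 1 3 4 5 6 * weight ζ 2 3 4 5 6 * ExteriorAlgebra.ι F v) =
        -ExteriorAlgebra.ι F (sum456 ζ vecW) := by
  have h56 : ζ 5 - ζ 6 ≠ 0 := fun h => absurd (hζ (by simp) (by simp) (sub_eq_zero.1 h))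
    (by decide)
  have hw : ∀ i ∈ ({1, 2, 3} : Set ℕ), rhsDual (-vecB i 4 5 6 : Gen κ →₀ F) = 1 := by
    intro i hi
    rcases hi with rfl | rfl | rfl <;> simp +decide [rhsDual, vecB_apply_b]
  have hc : (ζ 5 - ζ 6)⁻¹ * (ζ 5 - ζ 6)⁻¹ * (ζ 5 - ζ 6)⁻¹ *
      ((ζ 5 - ζ 6)⁻¹ * (ζ 5 - ζ 6)⁻¹) * (ζ 5 - ζ 6) ^ 5 = 1 := by
    field_simp
  have h12 := sum456_vecR_apply (κ := κ) ζ 1 2 (by simp)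
  have h13 := sum456_vecR_apply (κ := κ) ζ 1 3 (by simp)
  have h23 := sum456_vecR_apply (κ := κ) ζ 2 3 (by simp)
  have hX : ∀ i j k l, (i, j) ∈ ({(1, 2), (1, 3), (2, 3)} : Set (ℕ × ℕ)) →
      (k, l) ∈ ({(1, 2), (1, 3), (2, 3)} : Set (ℕ × ℕ)) →
      (weight ζ i j 4 5 6 * weight ζ k l 4 5 6 : Grassmann F (Gen κ)) ∈ dualKer rhsDual :=
    fun i j k l hij hkl =>
      mul_mem (weight_mem_dualKer_rhs ζ i j hij) (weight_mem_dualKer_rhs ζ k l hkl)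
  refine ⟨?_, ?_, ?_⟩
  · rw [berezinIter_mul_ι_congr _ _ rhsDual_mem (hX 1 2 1 3 (by simp) (by simp)) hv
        (hw 1 (by simp)),
      weight_eq_rhs, weight_eq_rhs, smul_prodι_mul_smul_prodι_mul_ι, berezinIter_smul]
    simp only [List.cons_append, List.nil_append]
    rw [berezinIter_rhsVars_prodι 1 2 3 (by simp), smul_smul, smul_smul, hc, one_smul, ← map_neg]
    · congr 1
      simp only [sum456, vecU]
      module
    · rintro x (rfl | rfl | rfl | rfl | rfl | rfl) n hn <;> simp [h12 n hn, h13 n hn]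
  · rw [berezinIter_mul_ι_congr _ _ rhsDual_mem (hX 1 2 2 3 (by simp) (by simp)) hv
        (hw 2 (by simp)),
      weight_eq_rhs', weight_eq_rhs, smul_prodι_mul_smul_prodι_mul_ι, berezinIter_smul]
    simp only [List.cons_append, List.nil_append]
    rw [berezinIter_rhsVars_prodι 2 1 3 (by simp), smul_smul, smul_smul, hc, one_smul]
    · congr 1
      simp only [sum456, vecV]
      module
    · rintro x (rfl | rfl | rfl | rfl | rfl | rfl) n hn <;> simp [h12 n hn, h23 n hn]
  · rw [berezinIter_mul_ι_congr _ _ rhsDual_mem (hX 1 3 2 3 (by simp) (by simp)) hv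
        (hw 3 (by simp)),
      weight_eq_rhs', weight_eq_rhs', smul_prodι_mul_smul_prodι_mul_ι, berezinIter_smul]
    simp only [List.cons_append, List.nil_append]
    rw [berezinIter_rhsVars_prodι 3 1 2 (by simp), smul_smul, smul_smul, hc, one_smul, ← map_neg]
    · congr 1
      simp only [sum456, vecW]
      module
    · rintro x (rfl | rfl | rfl | rfl | rfl | rfl) n hn <;> simp [h13 n hn, h23 n hn]

end Pairs

/-! ### The integrals of three deformed weights -/

section Assembly

variable {F : Type*} [Field F] {κ : Type*}

theorem vecUVW_apply (p q : ℕ) (h : (p, q) ∈ ({(4, 5), (4, 6), (5, 6)} : Set (ℕ × ℕ))) :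
    ∀ n ∈ innerVars κ, (vecU p q : Gen κ →₀ F) n = 0 ∧ (vecV p q : Gen κ →₀ F) n = 0 ∧
      (vecW p q : Gen κ →₀ F) n = 0 := by
  rintro n (hn | hn) <;> rcases h with h | h | h <;> obtain ⟨rfl, rfl⟩ := Prod.mk.inj h <;>
  fin_cases hn <;>
  simp +decide [vecU, vecV, vecW, vecA_apply_a, vecA_apply_b, vecB_apply_a, vecB_apply_b]

/-- Modulo the factors of the first two weights, those of the third one are outer vectors. -/
theorem weight_mul_weight_mul_weight_lhs (ζ : ℕ → F) :
    (weight ζ 1 2 3 4 5 * weight ζ 1 2 3 4 6 * weight ζ 1 2 3 5 6 : Grassmann F (Gen κ)) =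
      (ζ 5 - ζ 6)⁻¹ • (weight ζ 1 2 3 4 5 * weight ζ 1 2 3 4 6 *
        prodι [sum456 ζ vecU, sum456 ζ vecV, sum456 ζ vecW]) := by
  simp only [weight_eq, ← prodι_append, mul_smul_comm, smul_mul_assoc,
    List.cons_append, List.nil_append]
  rw [prodι_set _ 6 (by simp) (sum456 ζ vecU) [-1, 0, 0, 1] (by simp [sum456, vecU]; module)]
  simp only [List.set_cons_succ, List.set_cons_zero]
  rw [prodι_set _ 7 (by simp) (sum456 ζ vecV) [0, -1, 0, 0, 1] (by simp [sum456, vecV]; module)]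
  simp only [List.set_cons_succ, List.set_cons_zero]
  rw [prodι_set _ 8 (by simp) (sum456 ζ vecW) [0, 0, -1, 0, 0, 1] (by simp [sum456, vecW]; module)]
  simp only [List.set_cons_succ, List.set_cons_zero]

theorem weight_mul_weight_mul_weight_rhs (ζ : ℕ → F) :
    (weight ζ 1 2 4 5 6 * weight ζ 1 3 4 5 6 * weight ζ 2 3 4 5 6 : Grassmann F (Gen κ)) =
      (ζ 5 - ζ 6)⁻¹ • (weight ζ 1 2 4 5 6 * weight ζ 1 3 4 5 6 *
        prodι [sum456 ζ vecV, sum456 ζ vecW, vecT ζ 4 6 - vecT ζ 4 5]) := by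
  simp only [weight_eq_rhs, ← prodι_append, mul_smul_comm, smul_mul_assoc,
    List.cons_append, List.nil_append]
  rw [prodι_set _ 6 (by simp) (sum456 ζ vecV) [0, -1] (by simp [sum456, vecV]; module)]
  simp only [List.set_cons_succ, List.set_cons_zero]
  rw [prodι_set _ 7 (by simp) (sum456 ζ vecW) [0, 0, 0, 0, 1] (by simp [sum456, vecW]; module)]
  simp only [List.set_cons_succ, List.set_cons_zero]
  rw [prodι_set _ 8 (by simp) (vecT ζ 4 6 - vecT ζ 4 5) [0, 0, -1, 0, 0, 1]
    (by simp [vecR, vecT, vecU, vecV, vecW]; module)]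
  simp only [List.set_cons_succ, List.set_cons_zero]

theorem berezinIter_mul_prodι {l : List (Gen κ)} {A B : Grassmann F (Gen κ)}
    (hA : IsOdd A) (hB : IsOdd B) (x y z v : Gen κ →₀ F)
    (h : ∀ n ∈ l, x n = 0 ∧ y n = 0 ∧ z n = 0) :
    berezinIter l (A * B * prodι [x, y, z] * ExteriorAlgebra.ι F v) =
      prodι [x, y, z] * berezinIter l (A * B * ExteriorAlgebra.ι F v) := by
  rw [(hA.mul hB).commute, mul_assoc, berezinIter_mul]
  simp only [prodι_cons, prodι_nil, mul_one]
  exact mul_mem (independentOf_ι fun n hn => (h n hn).1)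
    (mul_mem (independentOf_ι fun n hn => (h n hn).2.1) (independentOf_ι fun n hn => (h n hn).2.2))

theorem berezinIter_deformed (l : List (Gen κ)) {A B C a b c e : Grassmann F (Gen κ)}
    (hA : IsOdd A) (hB : IsOdd B) (hb : IsEven b) (hc : IsEven c) (he : IsOdd e) (hee : e * e = 0)
    (hae : IndependentOf {n | n ∈ l} (a * e)) (hbe : IndependentOf {n | n ∈ l} (b * e))
    (hce : IndependentOf {n | n ∈ l} (c * e)) (k : F) (x : Grassmann F (Gen κ)) :
    k • berezinIter l ((A + a * e) * (B + b * e) * (C + c * e) * x) =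
      k • berezinIter l (A * B * C * x) + a * e * k • berezinIter l (B * C * x)
        - b * e * k • berezinIter l (A * C * x) + c * e * k • berezinIter l (A * B * x) := by
  have h : ∀ a X, IndependentOf {n | n ∈ l} (a * e) →
      berezinIter l (a * e * X * x) = a * e * berezinIter l (X * x) := fun a X ha => by
    rw [mul_assoc, berezinIter_mul l _ _ ha]
  rw [mul_deformed hA hB hb hc he hee, add_mul, sub_mul, add_mul, berezinIter_add,
    sub_eq_add_neg, berezinIter_add, berezinIter_neg, berezinIter_add, h a _ hae, h b _ hbe,
    h c _ hce]
  simp only [mul_smul_comm]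
  module

theorem sum456_apply (ζ : ℕ → F) {x : ℕ → ℕ → Gen κ →₀ F} {n : Gen κ} (h45 : x 4 5 n = 0)
    (h46 : x 4 6 n = 0) (h56 : x 5 6 n = 0) : sum456 ζ x n = 0 := by
  simp [sum456, h45, h46, h56]

/-- The identity for the undeformed weights. Both sides are equal to
`ζ₅₆⁻¹ ∂u ∂v ∂w (T₄₆ - T₄₅)`. -/
theorem berezinIter_weights {ζ : ℕ → F} (hζ : Set.InjOn ζ (Set.Icc 1 6)) {v w : Gen κ →₀ F}
    (hv : lhsDual ζ v = 1) (hw : rhsDual w = 1) :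
    ((ζ 3 - ζ 4)⁻¹ * (ζ 3 - ζ 5)⁻¹ * (ζ 3 - ζ 6)⁻¹) • berezinIter (lhsVars κ)
      (weight ζ 1 2 3 4 5 * weight ζ 1 2 3 4 6 * weight ζ 1 2 3 5 6 * ExteriorAlgebra.ι F v) =
    ((ζ 5 - ζ 6)⁻¹ * (ζ 5 - ζ 6)⁻¹ * (ζ 5 - ζ 6)⁻¹) • berezinIter (rhsVars κ)
      (weight ζ 1 2 4 5 6 * weight ζ 1 3 4 5 6 * weight ζ 2 3 4 5 6 * ExteriorAlgebra.ι F w) := by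
  have hodd := fun i j k l m => isOdd_weight (κ := κ) ζ i j k l m
  have o45 := vecUVW_apply (F := F) (κ := κ) 4 5 (by simp)
  have o46 := vecUVW_apply (F := F) (κ := κ) 4 6 (by simp)
  have o56 := vecUVW_apply (F := F) (κ := κ) 5 6 (by simp)
  have hbd : ∀ n ∈ innerVars κ,
      sum456 ζ vecU n = 0 ∧ sum456 ζ vecV n = 0 ∧ sum456 ζ vecW n = 0 := fun n hn =>
    ⟨sum456_apply ζ (o45 n hn).1 (o46 n hn).1 (o56 n hn).1,
      sum456_apply ζ (o45 n hn).2.1 (o46 n hn).2.1 (o56 n hn).2.1,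
      sum456_apply ζ (o45 n hn).2.2 (o46 n hn).2.2 (o56 n hn).2.2⟩
  have hT : ∀ n ∈ innerVars κ, (vecT ζ 4 6 - vecT ζ 4 5 : Gen κ →₀ F) n = 0 := fun n hn => by
    simp [vecT, o45 n hn, o46 n hn]
  rw [weight_mul_weight_mul_weight_lhs, weight_mul_weight_mul_weight_rhs, smul_mul_assoc,
    smul_mul_assoc, berezinIter_smul, berezinIter_smul,
    berezinIter_mul_prodι (hodd _ _ _ _ _) (hodd _ _ _ _ _) _ _ _ _ fun n hn => hbd n (Or.inl hn),
    berezinIter_mul_prodι (hodd _ _ _ _ _) (hodd _ _ _ _ _) _ _ _ _ fun n hn =>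
      ⟨(hbd n (Or.inr hn)).2.1, (hbd n (Or.inr hn)).2.2, hT n (Or.inr hn)⟩,
    smul_comm ((ζ 3 - ζ 4)⁻¹ * _ * _), smul_comm ((ζ 5 - ζ 6)⁻¹ * _ * _),
    ← mul_smul_comm ((ζ 3 - ζ 4)⁻¹ * _ * _),
    ← mul_smul_comm ((ζ 5 - ζ 6)⁻¹ * _ * _),
    berezinIter_lhs hζ hv 4 5 6 (by simp), (berezinIter_rhs hζ hw).1]
  congr 1
  simp only [prodι_cons, prodι_nil, mul_one, mul_neg]
  have h := ι_mul_prodι (sum456 ζ vecU : Gen κ →₀ F)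
    [sum456 ζ vecV, sum456 ζ vecW, vecT ζ 4 6 - vecT ζ 4 5]
  simp only [prodι_cons, prodι_nil, mul_one, List.length_cons, List.length_nil] at h
  rw [mul_assoc, mul_assoc, h]
  module

/-- The identity for face weights of degree one. Once the integrals of two and of three weights are
known, it is a linear combination of link relations multiplied by `e` and an outer vector. -/
theorem berezinIter_deformedWeights (hF : ringChar F ≠ 2) {ζ : ℕ → F}
    (hζ : Set.InjOn ζ (Set.Icc 1 6))
    {ε : Finset ℕ → ℤˣ} (hε : IsConsistentOrientation ε lhs33 rhs33)
    {e : Grassmann F (Gen κ)} (he : IsOdd e) (he_indep : IndependentOf (innerVars κ) e)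
    {α : Finset ℕ → Grassmann F (Gen κ)}
    (hα : ∀ u ∈ lhs33 ∪ rhs33, IsEven (α u) ∧ IndependentOf (innerVars κ) (α u))
    (hlink : LinkRelations ζ ε lhs33 rhs33 α) {v w : Gen κ →₀ F} (hv : lhsDual ζ v = 1)
    (hw : rhsDual w = 1) :
    ((ζ 3 - ζ 4)⁻¹ * (ζ 3 - ζ 5)⁻¹ * (ζ 3 - ζ 6)⁻¹) • berezinIter (lhsVars κ)
      (deformedWeight ζ α e 1 2 3 4 5 * deformedWeight ζ α e 1 2 3 4 6
        * deformedWeight ζ α e 1 2 3 5 6 * ExteriorAlgebra.ι F v) =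
    ((ζ 5 - ζ 6)⁻¹ * (ζ 5 - ζ 6)⁻¹ * (ζ 5 - ζ 6)⁻¹) • berezinIter (rhsVars κ)
      (deformedWeight ζ α e 1 2 4 5 6 * deformedWeight ζ α e 1 3 4 5 6
        * deformedWeight ζ α e 2 3 4 5 6 * ExteriorAlgebra.ι F w) := by
  have hee := he.mul_self hF
  have hodd := fun i j k l m => isOdd_weight (κ := κ) ζ i j k l m
  have hindL : ∀ u ∈ lhs33 ∪ rhs33, IndependentOf {n | n ∈ lhsVars κ} (α u * e) := fun u hu =>
    IndependentOf.mono (fun n hn => Or.inl hn) (mul_mem (hα u hu).2 he_indep)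
  have hindR : ∀ u ∈ lhs33 ∪ rhs33, IndependentOf {n | n ∈ rhsVars κ} (α u * e) := fun u hu =>
    IndependentOf.mono (fun n hn => Or.inr hn) (mul_mem (hα u hu).2 he_indep)
  have h45 := berezinIter_lhs hζ hv 4 5 6 (by simp)
  have h54 := berezinIter_lhs hζ hv 5 4 6 (by simp)
  have h64 := berezinIter_lhs hζ hv 6 4 5 (by simp)
  rw [weight_swap ζ 1 2 3 4 5] at h54
  rw [weight_swap ζ 1 2 3 4 6, weight_swap ζ 1 2 3 5 6] at h64
  obtain ⟨r1, r2, r3⟩ := berezinIter_rhs hζ hw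
  simp only [deformedWeight]
  rw [berezinIter_deformed _ (hodd _ _ _ _ _) (hodd _ _ _ _ _) (hα _ (by decide +kernel)).1
      (hα _ (by decide +kernel)).1 he hee (hindL _ (by decide +kernel))
      (hindL _ (by decide +kernel)) (hindL _ (by decide +kernel)),
    berezinIter_deformed _ (hodd _ _ _ _ _) (hodd _ _ _ _ _) (hα _ (by decide +kernel)).1
      (hα _ (by decide +kernel)).1 he hee (hindR _ (by decide +kernel))
      (hindR _ (by decide +kernel)) (hindR _ (by decide +kernel)),
    berezinIter_weights hζ hv hw, h45, h54, h64, r1, r2, r3]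
  have hrel : ∀ i j k p q r x, (i, j, k) ∈ ({(1, 2, 3), (2, 1, 3), (3, 1, 2)} : Set (ℕ × ℕ × ℕ)) →
      (p, q, r) ∈ ({(4, 5, 6), (4, 6, 5), (5, 6, 4)} : Set (ℕ × ℕ × ℕ)) →
      (ζ i - ζ q) • (α {1, 2, 3, q, r} * e * ExteriorAlgebra.ι F x)
        - (ζ i - ζ p) • (α {1, 2, 3, p, r} * e * ExteriorAlgebra.ι F x) =
      (ζ p - ζ q) • (α {j, k, 4, 5, 6} * e * ExteriorAlgebra.ι F x) := by
    intro i j k p q r x hi hp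
    rw [← smul_mul_assoc, ← smul_mul_assoc, ← smul_mul_assoc, ← smul_mul_assoc, ← smul_mul_assoc,
      ← smul_mul_assoc, ← LinkRelations.eq hε hlink i j k p q r hi hp, sub_mul, sub_mul]
  have e1 : ({1, 2, 3, 5, 4} : Finset ℕ) = {1, 2, 3, 4, 5} := by decide
  have e2 : ({1, 2, 3, 6, 4} : Finset ℕ) = {1, 2, 3, 4, 6} := by decide
  have e3 : ({1, 2, 3, 6, 5} : Finset ℕ) = {1, 2, 3, 5, 6} := by decide
  have hr45 := fun i j k x hi => hrel i j k 4 5 6 x hi (by simp)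
  have hr46 := fun i j k x hi => hrel i j k 4 6 5 x hi (by simp)
  have hr56 := fun i j k x hi => hrel i j k 5 6 4 x hi (by simp)
  simp only [e1, e2, e3] at hr45 hr46 hr56
  have hA : ∀ i j p q, (vecA i j q p : Gen κ →₀ F) = vecA i j p q := fun i j p q => by
    rw [vecA, vecA, Finset.pair_comm]
  have hB : ∀ i j p q, (vecB i j q p : Gen κ →₀ F) = vecB i j p q := fun i j p q => by
    rw [vecB, vecB, Finset.pair_comm]
  have hU : ∀ p q, (vecU q p : Gen κ →₀ F) = vecU p q := fun p q => by
    rw [vecU, vecU, hA, hA 1 3]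
  have hV : ∀ p q, (vecV q p : Gen κ →₀ F) = vecV p q := fun p q => by
    rw [vecV, vecV, hA, hB]
  have hW : ∀ p q, (vecW q p : Gen κ →₀ F) = vecW p q := fun p q => by
    rw [vecW, vecW, hB, hB 1 3]
  simp only [vecT, sum456, hU 4 5, hV 4 5, hW 4 5, hU 4 6, hV 4 6, hW 4 6, hU 5 6, hV 5 6, hW 5 6,
    map_sub, map_add, map_smul, mul_sub, mul_add, mul_smul_comm, mul_neg]
  -- The link relations of the nine faces with two vertices in `123` and one vertex in `456`.
  linear_combination (norm := module)
    -hr45 1 2 3 (vecU 4 5) (by simp) + hr46 1 2 3 (vecU 4 6) (by simp)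
    - hr56 1 2 3 (vecU 5 6) (by simp) - hr45 2 1 3 (vecV 4 5) (by simp)
    + hr46 2 1 3 (vecV 4 6) (by simp) - hr56 2 1 3 (vecV 5 6) (by simp)
    - hr45 3 1 2 (vecW 4 5) (by simp) + hr46 3 1 2 (vecW 4 6) (by simp)
    - hr56 3 1 2 (vecW 5 6) (by simp)

end Assembly

end Pachner

end

theorem mainTheorem3 {F : Type*} [Field F] (hF : ringChar F ≠ 2) {κ : Type*}
    (ζ : ℕ → F) (hζ : Set.InjOn ζ (Set.Icc 1 6))
    (ε : Finset ℕ → ℤˣ)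
    (hε : Pachner.IsConsistentOrientation ε Pachner.lhs33 Pachner.rhs33)
    (e : Pachner.Grassmann F (Pachner.Gen κ))
    (he : Pachner.IsOdd e)
    (he_indep : Pachner.IndependentOf (Pachner.innerVars κ) e)
    (α : Finset ℕ → Pachner.Grassmann F (Pachner.Gen κ))
    (hα : ∀ u ∈ Pachner.lhs33 ∪ Pachner.rhs33,
      Pachner.IsEven (α u) ∧ Pachner.IndependentOf (Pachner.innerVars κ) (α u))
    (hlink : Pachner.LinkRelations ζ ε Pachner.lhs33 Pachner.rhs33 α) :
    -- the identity, for every choice of the two face weights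
    (∀ w123 w456 : Pachner.Grassmann F (Pachner.Gen κ),
      Pachner.IsInverseOne (Pachner.faceOp ζ Pachner.lhs33 {1, 2, 3}) w123 →
      Pachner.IsInverseOne (Pachner.faceOp ζ Pachner.rhs33 {4, 5, 6}) w456 →
      ((ζ 3 - ζ 4)⁻¹ * (ζ 3 - ζ 5)⁻¹ * (ζ 3 - ζ 6)⁻¹) •
        Pachner.berezinIter (Pachner.lhsVars κ)
          (Pachner.deformedWeight ζ α e 1 2 3 4 5 * Pachner.deformedWeight ζ α e 1 2 3 4 6
            * Pachner.deformedWeight ζ α e 1 2 3 5 6 * w123) =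
      ((ζ 5 - ζ 6)⁻¹ * (ζ 5 - ζ 6)⁻¹ * (ζ 5 - ζ 6)⁻¹) •
        Pachner.berezinIter (Pachner.rhsVars κ)
          (Pachner.deformedWeight ζ α e 1 2 4 5 6 * Pachner.deformedWeight ζ α e 1 3 4 5 6
            * Pachner.deformedWeight ζ α e 2 3 4 5 6 * w456)) ∧
    -- examples of face weights
    Pachner.IsInverseOne (Pachner.faceOp ζ Pachner.lhs33 {1, 2, 3})
      (((ζ 2 - ζ 3)⁻¹ * (ζ 3 - ζ 4)) •
        (Pachner.ga 1 2 3 4 : Pachner.Grassmann F (Pachner.Gen κ))) ∧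
    Pachner.IsInverseOne (Pachner.faceOp ζ Pachner.rhs33 {4, 5, 6})
      (-(Pachner.gb 1 4 5 6 : Pachner.Grassmann F (Pachner.Gen κ))) := by
  open Pachner in
  rw [faceOp_lhs, faceOp_rhs]
  refine ⟨fun w123 w456 h123 h456 => ?_, ?_, ?_⟩
  · obtain ⟨v, hv, rfl⟩ := h123.exists_ι
    obtain ⟨w, hw, rfl⟩ := h456.exists_ι
    exact berezinIter_deformedWeights hF hζ hε he he_indep hα hlink hv hw
  · have h23 : ζ 2 - ζ 3 ≠ 0 := fun h => absurd (hζ (by simp) (by simp) (sub_eq_zero.1 h))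
      (by decide)
    have h34 : ζ 3 - ζ 4 ≠ 0 := fun h => absurd (hζ (by simp) (by simp) (sub_eq_zero.1 h))
      (by decide)
    have hd : lhsDual ζ (((ζ 2 - ζ 3)⁻¹ * (ζ 3 - ζ 4)) • vecA 1 2 3 4 : Gen κ →₀ F) = 1 := by
      simp +decide [lhsDual, vecA_apply_a, vecA_apply_b]
      field_simp
    have h := isInverseOne_ι hd
    rwa [map_smul] at h
  · have hd : rhsDual (-vecB 1 4 5 6 : Gen κ →₀ F) = 1 := by
      simp +decide [rhsDual, vecB_apply_b]
    have h := isInverseOne_ι hd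
    rwa [map_neg] at h
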